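/- Let $n\ge 1$ and $\mathbf b=(b_1,\dots,b_n)\in\mathbb Z_{>0}^n$, excluding the degenerate case $n=1=b_1$, and put $S_i=b_1+\cdots+b_i$. A $\mathbf b$-parking function is a list of $n$ positive integers whose nondecreasing rearrangement $\beta_1'\le\cdots\le\beta_n'$ satisfies $\beta_i'\le S_i$ for all $i$; let $\mathfrak X_n(\mathbf b)\subset\mathbb R^n$ be the convex hull of all $\mathbf b$-parking functions. Define collections of subsets of $[n+1]$ by $$\mathcal B_{\mathsf{St}_n}=\{\{1\},\dots,\{n\}\}\cup\{S\cup\{n+1\}: S\subseteq[n]\},$$ $$\mathcal B_{\mathsf{PF}_n}=\{\{1\},\dots,\{n\}\}\cup\{S\cup\{n+1\}: S\subseteq[n],\ |S|\ne 1\},$$ which are building sets, and let $\mathcal B=\mathcal B_{\mathsf{PF}_n}$ if $b_1=1$ and $\mathcal B=\mathcal B_{\mathsf{St}_n}$ if $b_1\ge 2$. Let $\mathcal B_{\max}$ be the set of inclusion-maximal members of $\mathcal B$. A nested set of $\mathcal B$ is a subset $N\subseteq\mathcal B\setminus\mathcal B_{\max}$ such that any two members of $N$ are comparable under inclusion or disjoint,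 and the union of any $k\ge2$ pairwise disjoint members of $N$ is not in $\mathcal B$. The nested sets (including $\emptyset$) form the nested set complex $\Delta_{\mathcal B}$; its face lattice is the set of nested sets ordered by inclusion, with a greatest element $\hat 1$ adjoined. For $B\in\mathcal B\setminus\mathcal B_{\max}$ put $$F_{\{i\}}=\{x\in\mathfrak X_n(\mathbf b): x_i=1\}\quad(1\le i\le n),$$ $$F_{S\cup\{n+1\}}=\Bigl\{x\in\mathfrak X_n(\mathbf b): \sum_{i\in[n]\setminus S}x_i=\sum_{i=|S|+1}^{n}S_i\Bigr\}\quad(S\subsetneq[n]).$$ Theorem. The map $B\mapsto F_B$ is a bijection from $\mathcal B\setminus\mathcal B_{\max}$ onto the set of facets of $\mathfrak X_n(\mathbf b)$, and the map $$N\longmapsto \mathcal F_N=\bigcap_{B\in N}F_B \qquad(\mathcal F_\emptyset=\mathfrak X_n(\mathbf b)),$$ from the nested sets to the nonempty faces of $\mathfrak X_n(\mathbf b)$, together with $\hat 1\mapsto\emptyset$, is an isomorphism from the dual of the face lattice of $\Delta_{\mathcal B}$ onto the face lattice of $\mathfrak X_n(\mathbf b)$ (all faces, including $\emptyset$ and $\mathfrak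 X_n(\mathbf b)$, ordered by inclusion). -/

import Mathlib

/-! ### Building sets and nested sets -/

/-- A building set on `E`: a collection of nonempty subsets of `E` satisfying (B1) and (B2). -/
structure BuildingSet (E : Type*) [DecidableEq E] where
  sets : Set (Finset E)
  nonempty_of_mem : ∀ I ∈ sets, I.Nonempty
  union_mem : ∀ I ∈ sets, ∀ J ∈ sets, (I ∩ J).Nonempty → I ∪ J ∈ sets
  singleton_mem : ∀ i : E, {i} ∈ sets

namespace BuildingSet

variable {E : Type*} [DecidableEq E]

/-- The collection of the members of the building set that are maximal under inclusion. -/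
def maxSets (B : BuildingSet E) : Set (Finset E) := {I | Maximal (· ∈ B.sets) I}

/-- Nested sets of a building set. In (N2) the pairwise disjoint sets `J₁, …, J_k` with `k ≥ 2` form
a subfamily `M` of `N` with at least two members (they are nonempty, hence distinct). -/
structure IsNested (B : BuildingSet E) (N : Finset (Finset E)) : Prop where
  subset : (N : Set (Finset E)) ⊆ B.sets \ B.maxSets
  laminar : ∀ I ∈ N, ∀ J ∈ N, I ⊆ J ∨ J ⊆ I ∨ Disjoint I J
  union_notMem : ∀ M ⊆ N, 2 ≤ M.card →
    (∀ I ∈ M, ∀ J ∈ M, I ≠ J → Disjoint I J) → M.biUnion id ∉ B.sets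

/-- The nested set complex: all nested sets (including `∅`), ordered by inclusion. -/
abbrev NestedSetComplex (B : BuildingSet E) : Type _ :=
  {N : Finset (Finset E) // B.IsNested N}

/-- The face lattice of the nested set complex: its faces, ordered by inclusion, together with an
adjoined greatest element. -/
abbrev NestedFaceLattice (B : BuildingSet E) : Type _ := WithTop B.NestedSetComplex

end BuildingSet

/- The ground set `[n+1]` is `Fin (n + 1)`: `i.castSucc` for `i : Fin n` are the elements of `[n]`,
and `Fin.last n` is the element `n + 1`. -/

/-- The building set `{{1}, …, {n}} ∪ {S ∪ {n+1} : S ⊆ [n]}` of the stellohedron. -/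
def buildingSetSt (n : ℕ) : BuildingSet (Fin (n + 1)) where
  sets := {I | (∃ i : Fin n, I = {i.castSucc}) ∨
    ∃ S : Finset (Fin n), I = insert (Fin.last n) (S.map Fin.castSuccEmb)}
  nonempty_of_mem := by
    rintro I (⟨i, rfl⟩ | ⟨S, rfl⟩) <;> simp
  union_mem := by
    rintro I (⟨i, rfl⟩ | ⟨S, rfl⟩) J (⟨j, rfl⟩ | ⟨T, rfl⟩) h
    · left
      refine ⟨i, ?_⟩
      obtain ⟨x, hx⟩ := h
      simp only [Finset.mem_inter, Finset.mem_singleton] at hx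
      rw [← hx.1, ← hx.2, Finset.union_self]
    · right
      exact ⟨insert i T, by ext x; simp⟩
    · right
      exact ⟨insert j S, by ext x; simp⟩
    · right
      exact ⟨S ∪ T, by ext x; simp [or_and_right, exists_or]⟩
  singleton_mem := by
    intro i
    induction i using Fin.lastCases with
    | last => exact Or.inr ⟨∅, by simp⟩
    | cast i => exact Or.inl ⟨i, rfl⟩

/-- The building set `{{1}, …, {n}} ∪ {S ∪ {n+1} : S ⊆ [n], |S| ≠ 1}` of the classical
parking-function polytope. -/
def buildingSetPF (n : ℕ) : BuildingSet (Fin (n + 1)) where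
  sets := {I | (∃ i : Fin n, I = {i.castSucc}) ∨
    ∃ S : Finset (Fin n), S.card ≠ 1 ∧ I = insert (Fin.last n) (S.map Fin.castSuccEmb)}
  nonempty_of_mem := by
    rintro I (⟨i, rfl⟩ | ⟨S, -, rfl⟩) <;> simp
  union_mem := by
    rintro I (⟨i, rfl⟩ | ⟨S, hS, rfl⟩) J (⟨j, rfl⟩ | ⟨T, hT, rfl⟩) h
    · left
      refine ⟨i, ?_⟩
      obtain ⟨x, hx⟩ := h
      simp only [Finset.mem_inter, Finset.mem_singleton] at hx
      rw [← hx.1, ← hx.2, Finset.union_self]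
    · right
      have hi : i ∈ T := by
        obtain ⟨x, hx⟩ := h
        simp only [Finset.mem_inter, Finset.mem_singleton] at hx
        obtain ⟨rfl, hx⟩ := hx
        simpa using hx
      refine ⟨T, hT, ?_⟩
      rw [Finset.union_eq_right]
      simp [hi]
    · right
      have hj : j ∈ S := by
        obtain ⟨x, hx⟩ := h
        simp only [Finset.mem_inter, Finset.mem_singleton] at hx
        obtain ⟨hx, rfl⟩ := hx
        simpa using hx
      refine ⟨S, hS, ?_⟩
      rw [Finset.union_eq_left]
      simp [hj]
    · right
      refine ⟨S ∪ T, ?_, by ext x; simp [or_and_right, exists_or]⟩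
      intro hc
      have h1 := Finset.card_le_card (Finset.subset_union_left (s₁ := S) (s₂ := T))
      have h2 := Finset.card_le_card (Finset.subset_union_right (s₁ := S) (s₂ := T))
      have h3 := Finset.card_union_le S T
      omega
  singleton_mem := by
    intro i
    induction i using Fin.lastCases with
    | last => exact Or.inr ⟨∅, by simp⟩
    | cast i => exact Or.inl ⟨i, rfl⟩

/-! ### Faces of a polytope -/

/-- The face lattice of a polytope `P`: its faces, including `P` and `∅`, ordered by inclusion. A
face is an exposed subset: it is empty or the set of maximizers over `P` of a linear functional. -/
abbrev PolytopeFaceLattice {n : ℕ} (P : Set (Fin n → ℝ)) : Type :=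
  {F : Set (Fin n → ℝ) // IsExposed ℝ P F}

/-- A facet of `P`: a maximal proper face. -/
def IsFacet {n : ℕ} (P F : Set (Fin n → ℝ)) : Prop :=
  Maximal (fun G : Set (Fin n → ℝ) => IsExposed ℝ P G ∧ G ≠ P) F

/-! ### The parking-function polytope -/

section Parking

variable {n : ℕ}

/-- The partial sums `S_i = b_1 + ⋯ + b_i`. -/
def partialSum (b : Fin n → ℕ) (i : Fin n) : ℕ := ∑ j ∈ Finset.Iic i, b j

/-- `a` is a `b`-parking function: its entries are positive, and its nondecreasing rearrangement
`a ∘ Tuple.sort a` is bounded by the partial sums of `b`. -/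
def IsParkingFunction (b a : Fin n → ℕ) : Prop :=
  (∀ i, 0 < a i) ∧ ∀ i, a (Tuple.sort a i) ≤ partialSum b i

/-- The convex hull in `ℝⁿ` of all `b`-parking functions. -/
def parkingPolytope (b : Fin n → ℕ) : Set (Fin n → ℝ) :=
  convexHull ℝ {x | ∃ a : Fin n → ℕ, IsParkingFunction b a ∧ x = fun i => (a i : ℝ)}

/-- `L_i`: the points of the polytope with `x_i = 1`. -/
def lowerFacet (b : Fin n → ℕ) (i : Fin n) : Set (Fin n → ℝ) :=
  {x ∈ parkingPolytope b | x i = 1}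

/-- `U_I`: the points of the polytope with `∑_{i ∈ I} x_i = ∑_{i = n - |I| + 1}^{n} S_i` (with
indices starting at `0`, the range on the right is `n - |I| ≤ i`). -/
def upperFacet (b : Fin n → ℕ) (I : Finset (Fin n)) : Set (Fin n → ℝ) :=
  {x ∈ parkingPolytope b |
    ∑ i ∈ I, x i = ∑ i : Fin n with n ≤ i.val + I.card, (partialSum b i : ℝ)}

/-- The set `F_B`. If `n + 1 ∈ B`, write `B = S ∪ {n+1}` with `S ⊆ [n]`; then `F_B = U_{[n] \ S}`.
If `n + 1 ∉ B`, then a member `B` of the building sets is a singleton `{i}` with `i ∈ [n]`, and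
`F_B = L_i`. -/
def facetOf (b : Fin n → ℕ) (B : Finset (Fin (n + 1))) : Set (Fin n → ℝ) :=
  if Fin.last n ∈ B then upperFacet b {i | i.castSucc ∉ B}
  else ⋂ i ∈ {i : Fin n | i.castSucc ∈ B}, lowerFacet b i

/-- `ℱ_N = ⋂_{B ∈ N} F_B`, an intersection of subsets of the polytope (so it is the whole polytope
for `N = ∅`). -/
def faceOf (b : Fin n → ℕ) (N : Finset (Finset (Fin (n + 1)))) : Set (Fin n → ℝ) :=
  {x ∈ parkingPolytope b | ∀ B ∈ N, x ∈ facetOf b B}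

end Parking

/-! Let f(k) be the sum of the k largest S_i (`topSum`). The polytope is cut out by x_i ≥ 1 and ∑_{i
∈ I} x_i ≤ f(|I|) for all I: for every linear functional the greedy algorithm gives a parking
function that does at least as well as a given solution x, and a separating hyperplane finishes
(`mem_parkingPolytope_iff`).

The S_i increase strictly, so f is strictly concave, and the sets I that are tight at a common point
form a chain. A tight set contains a coordinate equal to 1 only if b_1 = 1 and the set is [n], and
then only one coordinate equals 1. When I is encoded as ([n] \ I) ∪ {n+1}, these are exactly the
conditions for nestedness (`IsParkingBuildingSet.isNested_iff`). If b_1 = 1, the inequalities with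
|I| = n - 1 follow from the others, which is why |S| = 1 is then excluded.

Conversely, an explicit perturbation gives for each nested set N a point that lies on F_B for B in N
and for no other B (`IsParkingBuildingSet.exists_mem_facetOf_iff`). So the faces ℱ_N are nonempty,
and ℱ_N ⊆ ℱ_M forces M ⊆ N. Every nonempty face occurs, because it is cut out by the inequalities
tight at one of its points (`IsExposed.exists_eq_setOf_tight`). The facets are the faces of the
one-element nested sets. -/

/-! ### Sums of the largest partial sums -/

section TopSum

variable {n : ℕ}

/-- The sum of the `k` largest partial sums of `b`. -/
noncomputable def topSum (b : Fin n → ℕ) (k : ℕ) : ℝ :=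
  ∑ i : Fin n with n ≤ i.val + k, (partialSum b i : ℝ)

theorem partialSum_strictMono {b : Fin n → ℕ} (hb : ∀ i, 0 < b i) : StrictMono (partialSum b) := by
  intro i j hij
  unfold partialSum
  refine Finset.sum_lt_sum_of_subset (Finset.Iic_subset_Iic.2 hij.le) (i := j) (by simp)
    (by simpa using hij) (hb j) (fun _ _ _ => Nat.zero_le _)

theorem succ_le_partialSum {b : Fin n → ℕ} (hb : ∀ i, 0 < b i) (i : Fin n) :
    i.val + 1 ≤ partialSum b i := by
  have h := Finset.card_nsmul_le_sum (Finset.Iic i) b 1 (fun j _ => hb j)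
  simpa [partialSum] using h

theorem partialSum_zero (b : Fin n → ℕ) (hn : 0 < n) : partialSum b ⟨0, hn⟩ = b ⟨0, hn⟩ := by
  have : Finset.Iic (⟨0, hn⟩ : Fin n) = {⟨0, hn⟩} := by
    ext j; simp [Fin.le_def, Fin.ext_iff]
  simp [partialSum, this]

theorem topSum_zero (b : Fin n → ℕ) : topSum b 0 = 0 := by
  unfold topSum
  rw [Finset.filter_false_of_mem]
  · simp
  · intro i _
    have := i.2
    omega

theorem sum_filter_le_add_succ (v : Fin n → ℝ) {k : ℕ} (hk : k < n) :
    ∑ i : Fin n with n ≤ i.val + (k + 1), v i =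
      v ⟨n - k - 1, by omega⟩ + ∑ i : Fin n with n ≤ i.val + k, v i := by
  rw [← Finset.sum_insert (f := v)]
  · congr 1
    ext i
    simp only [Finset.mem_filter, Finset.mem_univ, true_and, Finset.mem_insert, Fin.ext_iff]
    omega
  · simp only [Finset.mem_filter, Finset.mem_univ, true_and]
    omega

theorem topSum_succ (b : Fin n → ℕ) {k : ℕ} (hk : k < n) :
    topSum b (k + 1) = partialSum b ⟨n - k - 1, by omega⟩ + topSum b k :=
  sum_filter_le_add_succ (fun i => (partialSum b i : ℝ)) hk

/-- The increments of `topSum` are partial sums taken in decreasing order, so m increments starting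
at p exceed m increments starting at q > p. -/
theorem topSum_strictConcave {b : Fin n → ℕ} (hb : ∀ i, 0 < b i) {p q m : ℕ} (hpq : p < q)
    (hm : 0 < m) (hn : q + m ≤ n) :
    topSum b (q + m) + topSum b p < topSum b (p + m) + topSum b q := by
  induction m, hm using Nat.le_induction with
  | base =>
    rw [topSum_succ b (by omega : q < n), topSum_succ b (by omega : p < n)]
    have : partialSum b ⟨n - q - 1, by omega⟩ < partialSum b ⟨n - p - 1, by omega⟩ :=
      partialSum_strictMono hb (Fin.mk_lt_mk.2 (by omega))
    have : (partialSum b ⟨n - q - 1, by omega⟩ : ℝ) < partialSum b ⟨n - p - 1, by omega⟩ := by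
      exact_mod_cast this
    linarith
  | succ m hm ih =>
    have ih := ih (by omega)
    rw [← add_assoc, ← add_assoc, topSum_succ b (by omega : q + m < n),
      topSum_succ b (by omega : p + m < n)]
    have : partialSum b ⟨n - (q + m) - 1, by omega⟩ < partialSum b ⟨n - (p + m) - 1, by omega⟩ :=
      partialSum_strictMono hb (Fin.mk_lt_mk.2 (by omega))
    have : (partialSum b ⟨n - (q + m) - 1, by omega⟩ : ℝ) <
        partialSum b ⟨n - (p + m) - 1, by omega⟩ := by
      exact_mod_cast this
    linarith

/-- Only the final segment attains the maximum among sets of a given size, and integrality makes the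
gap at least 1. This gap leaves room for the perturbation in `exists_sum_eq_topSum_iff`. -/
theorem sum_partialSum_add_one_le_or {b : Fin n → ℕ} (hb : ∀ i, 0 < b i) (J : Finset (Fin n)) :
    (∑ j ∈ J, (partialSum b j : ℝ)) + 1 ≤ topSum b J.card ∨
      J = Finset.univ.filter (fun i : Fin n => n ≤ i.val + J.card) := by
  induction J using Finset.induction_on_min with
  | empty =>
    right
    ext i
    have := i.2
    simp
  | insert a s has ih =>
    have ha : a ∉ s := fun h => lt_irrefl _ (has a h)
    have hcard : s.card ≤ n - 1 - a.val := by
      rw [← Fin.card_Ioi]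
      exact Finset.card_le_card fun x hx => Finset.mem_Ioi.2 (has x hx)
    have ha2 := a.2
    rw [Finset.sum_insert ha, Finset.card_insert_of_notMem ha,
      topSum_succ b (by omega : s.card < n)]
    have hmono := partialSum_strictMono hb
    have hle : (∑ j ∈ s, (partialSum b j : ℝ)) ≤ topSum b s.card := by
      rcases ih with ih | ih
      · linarith
      · conv_lhs => rw [ih]
        exact le_rfl
    rcases (show a ≤ ⟨n - s.card - 1, by omega⟩ from Fin.le_def.2 (by simp; omega)).lt_or_eq with
      hlt | heq
    · left
      have h1 : partialSum b a + 1 ≤ partialSum b ⟨n - s.card - 1, by omega⟩ := hmono hlt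
      have h2 : (partialSum b a : ℝ) + 1 ≤ partialSum b ⟨n - s.card - 1, by omega⟩ := by
        exact_mod_cast h1
      linarith
    · rcases ih with ih | ih
      · left
        rw [← heq]
        linarith
      · right
        ext i
        have hi : i ∈ s ↔ n ≤ i.val + s.card := by
          conv_lhs => rw [ih]
          simp
        simp only [Finset.mem_insert, hi, Finset.mem_filter, Finset.mem_univ, true_and]
        rw [Fin.ext_iff] at heq ⊢
        simp only at heq
        omega

theorem sum_partialSum_le_topSum {b : Fin n → ℕ} (hb : ∀ i, 0 < b i) (J : Finset (Fin n)) :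
    ∑ j ∈ J, (partialSum b j : ℝ) ≤ topSum b J.card := by
  rcases sum_partialSum_add_one_le_or hb J with h | h
  · linarith
  · conv_lhs => rw [h]
    exact le_rfl

end TopSum

/-! ### Inequality description of the polytope -/

section Inequalities

variable {n : ℕ}

/-- Abel summation: split off `c 0` times the full sum of `d`; the remaining coefficients `c i.succ
- c 0` are again nonnegative and monotone. -/
theorem sum_mul_nonneg_of_suffix_sums_nonneg : ∀ {n : ℕ} (c d : Fin n → ℝ), Monotone c →
    (∀ i, 0 ≤ c i) → (∀ k : Fin n, 0 ≤ ∑ i ∈ Finset.Ici k, d i) → 0 ≤ ∑ i, c i * d i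
  | 0, _, _, _, _, _ => by simp
  | n + 1, c, d, hc, hc0, hd => by
    have h := sum_mul_nonneg_of_suffix_sums_nonneg (fun i : Fin n => c i.succ - c 0)
      (fun i => d i.succ) (fun i j hij => by
        have := hc (Fin.succ_le_succ_iff.2 hij)
        simpa using this)
      (fun i => sub_nonneg.2 (hc (Fin.zero_le _)))
      (fun k => by
        have := hd k.succ
        rwa [← Fin.map_succEmb_Ici, Finset.sum_map] at this)
    have h0 := mul_nonneg (hc0 0) (hd 0)
    have hI : Finset.Ici (0 : Fin (n + 1)) = Finset.univ := by ext; simp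
    rw [hI, Fin.sum_univ_succ, mul_add, Finset.mul_sum] at h0
    rw [Fin.sum_univ_succ]
    simp only [sub_mul, Finset.sum_sub_distrib] at h
    linarith

/-- Pigeonhole: if the sorted value at j exceeded S_j, then n - j entries (0-based j) would exceed
S_j, while σ supplies j + 1 other entries that are at most S_j. -/
theorem isParkingFunction_of_comp_le {b a : Fin n → ℕ} (hb : ∀ i, 0 < b i) (ha : ∀ i, 0 < a i)
    (σ : Equiv.Perm (Fin n)) (h : ∀ i, a (σ i) ≤ partialSum b i) : IsParkingFunction b a := by
  refine ⟨ha, fun j => ?_⟩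
  by_contra! hlt
  have hS := (partialSum_strictMono hb).monotone
  have hdisj : Disjoint ((Finset.Ici j).map (Tuple.sort a).toEmbedding)
      ((Finset.Iic j).map σ.toEmbedding) := by
    rw [Finset.disjoint_left]
    rintro x hx hy
    simp only [Finset.mem_map, Finset.mem_Ici, Finset.mem_Iic, Equiv.coe_toEmbedding] at hx hy
    obtain ⟨i, hi, rfl⟩ := hx
    obtain ⟨k, hk, hki⟩ := hy
    have h1 : a (Tuple.sort a j) ≤ a (Tuple.sort a i) := Tuple.monotone_sort a hi
    have h2 := h k
    have h3 := hS hk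
    rw [hki] at h2
    omega
  have hc := Finset.card_le_univ (((Finset.Ici j).map (Tuple.sort a).toEmbedding) ∪
      ((Finset.Iic j).map σ.toEmbedding))
  rw [Finset.card_union_of_disjoint hdisj] at hc
  simp only [Finset.card_map, Fin.card_Ici, Fin.card_Iic, Fintype.card_fin] at hc
  have := j.2
  omega

theorem sum_le_topSum_of_isParkingFunction {b a : Fin n → ℕ} (hb : ∀ i, 0 < b i)
    (ha : IsParkingFunction b a) (I : Finset (Fin n)) :
    ∑ i ∈ I, (a i : ℝ) ≤ topSum b I.card := by
  have h := sum_partialSum_le_topSum hb (I.map (Tuple.sort a).symm.toEmbedding)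
  rw [Finset.card_map, Finset.sum_map] at h
  refine le_trans (Finset.sum_le_sum fun i _ => ?_) h
  have := ha.2 ((Tuple.sort a).symm i)
  rw [Equiv.apply_symm_apply] at this
  exact_mod_cast this

theorem finite_parkingFunctions (b : Fin n → ℕ) :
    {x : Fin n → ℝ | ∃ a : Fin n → ℕ, IsParkingFunction b a ∧ x = fun i => (a i : ℝ)}.Finite := by
  have : {a : Fin n → ℕ | IsParkingFunction b a}.Finite := by
    refine (Set.Finite.pi' (t := fun _ : Fin n => Set.Iic (∑ i, partialSum b i))
      (fun _ => Set.finite_Iic _)).subset ?_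
    intro a ha i
    have h := ha.2 ((Tuple.sort a).symm i)
    rw [Equiv.apply_symm_apply] at h
    exact h.trans (Finset.single_le_sum (f := partialSum b) (fun _ _ => Nat.zero_le _)
      (Finset.mem_univ _))
  refine (this.image fun a i => (a i : ℝ)).subset ?_
  rintro x ⟨a, ha, rfl⟩
  exact ⟨a, ha, rfl⟩

/-- The greedy choice: order the coordinates by c, give those with c > 0 the matching S_j and the
others the minimum 1. -/
theorem exists_isParkingFunction_sum_mul_le {b : Fin n → ℕ} (hb : ∀ i, 0 < b i) (c x : Fin n → ℝ)
    (h1 : ∀ i, 1 ≤ x i) (h2 : ∀ I : Finset (Fin n), ∑ i ∈ I, x i ≤ topSum b I.card) :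
    ∃ a : Fin n → ℕ, IsParkingFunction b a ∧ ∑ i, c i * x i ≤ ∑ i, c i * (a i : ℝ) := by
  set σ := Tuple.sort c with hσ
  have hc : Monotone (c ∘ σ) := Tuple.monotone_sort c
  have hpos : ∀ j, 1 ≤ partialSum b j := fun j => le_trans (by omega) (succ_le_partialSum hb j)
  refine ⟨fun i => if 0 < c i then partialSum b (σ.symm i) else 1,
    isParkingFunction_of_comp_le hb (fun i => ?_) σ (fun j => ?_), ?_⟩
  · split_ifs
    · exact hpos _
    · exact one_pos
  · split_ifs
    · simp
    · exact hpos j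
  -- Negative coefficients are truncated to 0 so that Abel summation applies; the terms lost have
  -- the right sign because x ≥ 1. Its suffix sums are nonnegative by the inequalities for the
  -- σ-images of final segments.
  have key := sum_mul_nonneg_of_suffix_sums_nonneg (fun j => max (c (σ j)) 0)
    (fun j => (partialSum b j : ℝ) - x (σ j)) (fun i j hij => max_le_max (hc hij) le_rfl)
    (fun _ => le_max_right _ _) (fun k => by
      rw [Finset.sum_sub_distrib, sub_nonneg]
      have := h2 ((Finset.Ici k).map σ.toEmbedding)
      rw [Finset.sum_map, Finset.card_map, Fin.card_Ici] at this
      refine this.trans (le_of_eq ?_)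
      unfold topSum
      congr 1
      ext i
      have := k.2
      simp only [Finset.mem_filter, Finset.mem_univ, true_and, Finset.mem_Ici, Fin.le_def]
      omega)
  rw [← Equiv.sum_comp σ, ← Equiv.sum_comp σ (fun i => c i * _), ← sub_nonneg,
    ← Finset.sum_sub_distrib]
  refine key.trans (Finset.sum_le_sum fun j _ => ?_)
  have hx := h1 (σ j)
  by_cases hcj : 0 < c (σ j)
  · simp only [hcj, if_true, Equiv.symm_apply_apply, max_eq_left hcj.le]
    linarith
  · simp only [hcj, if_false, max_eq_right (not_lt.1 hcj), Nat.cast_one, zero_mul]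
    nlinarith [not_lt.1 hcj]

theorem mem_parkingPolytope_iff {b : Fin n → ℕ} (hb : ∀ i, 0 < b i) (x : Fin n → ℝ) :
    x ∈ parkingPolytope b ↔
      (∀ i, 1 ≤ x i) ∧ ∀ I : Finset (Fin n), ∑ i ∈ I, x i ≤ topSum b I.card := by
  constructor
  · intro hx
    have hconv : Convex ℝ {x : Fin n → ℝ | (∀ i, 1 ≤ x i) ∧
        ∀ I : Finset (Fin n), ∑ i ∈ I, x i ≤ topSum b I.card} := by
      rintro y ⟨hy1, hy2⟩ z ⟨hz1, hz2⟩ s t hs ht hst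
      refine ⟨fun i => ?_, fun I => ?_⟩
      · have := hy1 i
        have := hz1 i
        simp only [Pi.add_apply, Pi.smul_apply, smul_eq_mul]
        nlinarith
      · have := hy2 I
        have := hz2 I
        simp only [Pi.add_apply, Pi.smul_apply, smul_eq_mul, Finset.sum_add_distrib,
          ← Finset.mul_sum]
        calc s * ∑ i ∈ I, y i + t * ∑ i ∈ I, z i
            ≤ s * topSum b I.card + t * topSum b I.card := by gcongr
          _ = topSum b I.card := by rw [← add_mul, hst, one_mul]
    refine convexHull_min ?_ hconv hx
    rintro _ ⟨a, ha, rfl⟩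
    exact ⟨fun i => Nat.one_le_cast.2 (ha.1 i), sum_le_topSum_of_isParkingFunction hb ha⟩
  · rintro ⟨h1, h2⟩
    by_contra hx
    obtain ⟨f, u, hf, hu⟩ := geometric_hahn_banach_closed_point (convex_convexHull ℝ _)
      ((finite_parkingFunctions b).isClosed_convexHull (𝕜 := ℝ)) hx
    have hfx : ∀ y : Fin n → ℝ, f y = ∑ i, f (Pi.single i 1) * y i := by
      intro y
      conv_lhs => rw [← Finset.univ_sum_single y, map_sum]
      refine Finset.sum_congr rfl fun i _ => ?_
      rw [mul_comm, ← smul_eq_mul, ← map_smul, ← Pi.single_smul, smul_eq_mul, mul_one]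
    obtain ⟨a, ha, hle⟩ := exists_isParkingFunction_sum_mul_le hb (fun i => f (Pi.single i 1)) x h1 h2
    have := hf _ (subset_convexHull ℝ _ ⟨a, ha, rfl⟩)
    rw [hfx] at this hu
    linarith

end Inequalities

/-! ### Exposed faces of polyhedra -/

section Polyhedron

open Filter Topology

variable {E ι : Type*} [AddCommGroup E] [Module ℝ E] [TopologicalSpace E]

/-- Inequalities tight at x stay tight along the line through y, and the finitely many slack ones
survive a small step by continuity. -/
theorem exists_pos_forall_add_smul_sub_le [Finite ι] (a : ι → E →L[ℝ] ℝ) (c : ι → ℝ) {x y : E}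
    (hx : ∀ j, a j x ≤ c j) (hy : ∀ j, a j x = c j → a j y = c j) :
    ∃ ε : ℝ, 0 < ε ∧ ∀ j, a j (x + ε • (x - y)) ≤ c j := by
  have key : ∀ᶠ ε : ℝ in 𝓝[>] 0, ∀ j, a j (x + ε • (x - y)) ≤ c j := by
    rw [eventually_all]
    intro j
    rcases (hx j).eq_or_lt with h | h
    · refine Eventually.of_forall fun ε => ?_
      simp [h, hy j h]
    · have hcont : ContinuousAt (fun ε : ℝ => a j x + ε * (a j x - a j y)) 0 := by fun_prop
      have := hcont.eventually_lt_const (show _ < c j by simpa using h)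
      filter_upwards [nhdsWithin_le_nhds this] with ε hε
      simpa using hε.le
  obtain ⟨ε, h1, h2⟩ := (key.and self_mem_nhdsWithin).exists
  exact ⟨ε, h2, h1⟩

/-- A nonempty exposed face of a polyhedron contains a point such that the face is cut out by the
inequalities that are tight at the point. -/
theorem IsExposed.exists_eq_setOf_tight [Finite ι] (a : ι → E →L[ℝ] ℝ) (c : ι → ℝ) {F : Set E}
    (hF : IsExposed ℝ {x | ∀ j, a j x ≤ c j} F) (hne : F.Nonempty) :
    ∃ x ∈ F, F = {y | (∀ j, a j y ≤ c j) ∧ ∀ j, a j x = c j → a j y = c j} := by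
  classical
  obtain ⟨l, hl⟩ := hF hne
  -- A point of F with fewest tight inequalities plays the role of a relative interior point.
  obtain ⟨x, hxF, hmin⟩ := exists_minimalFor_of_wellFoundedLT (· ∈ F)
    (fun x => Set.ncard {j | a j x = c j}) hne
  refine ⟨x, hxF, Set.Subset.antisymm (fun y hy => ?_) fun y hy => ?_⟩
  · have hx' := hxF
    have hy' := hy
    rw [hl] at hx' hy'
    refine ⟨hy'.1, ?_⟩
    -- The midpoint is tight only where both x and y are, so minimality at x forces y to be tight
    -- wherever x is.
    set z : E := (1 / 2 : ℝ) • x + (1 / 2 : ℝ) • y with hz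
    have haz : ∀ f : E →L[ℝ] ℝ, f z = 1 / 2 * f x + 1 / 2 * f y := fun f => by simp [hz]
    have hzF : z ∈ F := by
      rw [hl]
      refine ⟨fun j => ?_, fun w hw => ?_⟩
      · have := hx'.1 j
        have := hy'.1 j
        rw [haz]
        linarith
      · have := hx'.2 w hw
        have := hy'.2 w hw
        rw [haz]
        linarith
    have hsub : {j | a j z = c j} ⊆ {j | a j x = c j} := fun j hj => by
      have h1 := hx'.1 j
      have h2 := hy'.1 j
      simp only [Set.mem_ofPred_eq, haz] at hj ⊢
      linarith
    have heq : {j | a j z = c j} = {j | a j x = c j} :=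
      Set.eq_of_subset_of_ncard_le hsub
        (hmin hzF (Set.ncard_le_ncard hsub (Set.toFinite _))) (Set.toFinite _)
    intro j hj
    have hj' : j ∈ {j | a j z = c j} := heq ▸ hj
    simp only [Set.mem_ofPred_eq, haz] at hj'
    linarith
  · have hx' := hxF
    rw [hl] at hx' ⊢
    refine ⟨hy.1, fun w hw => (hx'.2 w hw).trans ?_⟩
    -- The segment from y to x can be prolonged beyond x inside the polyhedron; as x maximizes l,
    -- this gives l x ≤ l y.
    obtain ⟨ε, hε, h⟩ := exists_pos_forall_add_smul_sub_le a c hx'.1 hy.2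
    have := hx'.2 _ h
    simp only [map_add, map_smul, map_sub, smul_eq_mul] at this
    nlinarith

end Polyhedron

/-! ### Tight inequalities -/

section Tight

variable {n : ℕ} {b : Fin n → ℕ} {x : Fin n → ℝ}

/-- Uncrossing: for incomparable I and J, adding the inequalities for I ∪ J and I ∩ J contradicts
strict concavity. -/
theorem subset_or_subset_of_tight (hb : ∀ i, 0 < b i) (hx : x ∈ parkingPolytope b)
    {I J : Finset (Fin n)} (hI : ∑ i ∈ I, x i = topSum b I.card)
    (hJ : ∑ i ∈ J, x i = topSum b J.card) : I ⊆ J ∨ J ⊆ I := by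
  by_contra! h
  obtain ⟨hIJ, hJI⟩ := h
  rw [mem_parkingPolytope_iff hb] at hx
  have h1 : (I ∩ J).card < I.card := Finset.card_lt_card
    ⟨Finset.inter_subset_left, fun h => hIJ (h.trans Finset.inter_subset_right)⟩
  have h2 : (I ∩ J).card < J.card := Finset.card_lt_card
    ⟨Finset.inter_subset_right, fun h => hJI (h.trans Finset.inter_subset_left)⟩
  have h3 := Finset.card_union_add_card_inter I J
  have h4 := Finset.card_le_univ (I ∪ J)
  rw [Fintype.card_fin] at h4
  have h5 := topSum_strictConcave hb h1 (m := J.card - (I ∩ J).card) (by omega) (by omega)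
  rw [show I.card + (J.card - (I ∩ J).card) = (I ∪ J).card by omega,
    show (I ∩ J).card + (J.card - (I ∩ J).card) = J.card by omega] at h5
  have h6 := Finset.sum_union_inter (s₁ := I) (s₂ := J) (f := x)
  have h7 := hx.2 (I ∪ J)
  have h8 := hx.2 (I ∩ J)
  linarith

/-- Removing i lowers the sum by 1, so the increment of `topSum` at |I| is at most 1. That increment
is the partial sum at 0-based index n - |I|, hence at least n - |I| + 1; so |I| = n and b_1 = 1. -/
theorem eq_univ_of_tight_of_eq_one (hb : ∀ i, 0 < b i) (hx : x ∈ parkingPolytope b)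
    {I : Finset (Fin n)} (hI : ∑ i ∈ I, x i = topSum b I.card) {i : Fin n} (hi : i ∈ I)
    (hxi : x i = 1) (hn : 0 < n) :
    (b ⟨0, hn⟩ = 1 ∧ I = Finset.univ) ∧ ∑ j ∈ I.erase i, x j = topSum b (I.erase i).card := by
  rw [mem_parkingPolytope_iff hb] at hx
  have h1 := hx.2 (I.erase i)
  have hcard := Finset.card_erase_add_one hi
  have hle := Finset.card_le_univ I
  rw [Fintype.card_fin] at hle
  have h2 := Finset.add_sum_erase I x hi
  have h3 := topSum_succ b (show (I.erase i).card < n by omega)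
  have h4 := succ_le_partialSum hb ⟨n - (I.erase i).card - 1, by omega⟩
  rw [hcard] at h3
  have h5 : (partialSum b ⟨n - (I.erase i).card - 1, by omega⟩ : ℝ) ≤ 1 := by linarith
  have h6 : partialSum b ⟨n - (I.erase i).card - 1, by omega⟩ ≤ 1 := by exact_mod_cast h5
  simp only at h4
  have h7 : n - (I.erase i).card - 1 = 0 := by omega
  have h8 : partialSum b ⟨n - (I.erase i).card - 1, by omega⟩ = b ⟨0, hn⟩ := by
    rw [← partialSum_zero b hn]
    congr 2
  have h9 := hb ⟨0, hn⟩
  refine ⟨⟨by omega, ?_⟩, ?_⟩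
  · rw [← Finset.card_eq_iff_eq_univ, Fintype.card_fin]
    omega
  · rw [h8, show b ⟨0, hn⟩ = 1 by omega] at h3
    push_cast at h3
    linarith

theorem eq_of_tight_univ_of_eq_one (hb : ∀ i, 0 < b i) (hx : x ∈ parkingPolytope b)
    (hI : ∑ i, x i = topSum b (Finset.univ : Finset (Fin n)).card) {i j : Fin n}
    (hi : x i = 1) (hj : x j = 1) : i = j := by
  by_contra hij
  have hn : 0 < n := Fin.pos i
  have h1 := (eq_univ_of_tight_of_eq_one hb hx hI (Finset.mem_univ i) hi hn).2
  have h2 := (eq_univ_of_tight_of_eq_one hb hx h1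
    (Finset.mem_erase.2 ⟨Ne.symm hij, Finset.mem_univ j⟩) hj hn).1.2
  exact Finset.notMem_erase i Finset.univ (by rw [h2]; exact Finset.mem_univ i)

end Tight

/-! ### Points with prescribed tight inequalities -/

section Existence

variable {n : ℕ}

/-- A chain of subsets of `Fin n` consists of final segments, up to a permutation. -/
theorem exists_perm_mem_iff_of_chain (C : Finset (Finset (Fin n)))
    (hC : ∀ I ∈ C, ∀ J ∈ C, I ⊆ J ∨ J ⊆ I) :
    ∃ σ : Equiv.Perm (Fin n), ∀ I ∈ C, ∀ j, σ j ∈ I ↔ n ≤ j.val + I.card := by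
  classical
  -- Sorting by the number of members of the chain that contain a point makes every member an upper
  -- set.
  set h : Fin n → ℕ := fun i => (C.filter (i ∈ ·)).card with hh
  have hlt : ∀ I ∈ C, ∀ i ∈ I, ∀ j ∉ I, h j < h i := by
    intro I hI i hi j hj
    refine Finset.card_lt_card ⟨fun J hJ => ?_, fun hsub => ?_⟩
    · simp only [Finset.mem_filter] at hJ ⊢
      rcases hC I hI J hJ.1 with h | h
      · exact ⟨hJ.1, h hi⟩
      · exact absurd (h hJ.2) hj
    · have := hsub (Finset.mem_filter.2 ⟨hI, hi⟩)
      exact hj (Finset.mem_filter.1 this).2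
  have hmono : Monotone (h ∘ Tuple.sort h) := Tuple.monotone_sort h
  refine ⟨Tuple.sort h, fun I hI j => ?_⟩
  set J := I.map (Tuple.sort h).symm.toEmbedding with hJ
  have hmem : ∀ j, j ∈ J ↔ Tuple.sort h j ∈ I := fun j => by simp [hJ]
  have hcard : J.card = I.card := Finset.card_map _
  have hup : ∀ i j, i ∈ J → i ≤ j → j ∈ J := by
    intro i j hi hij
    rw [hmem] at hi ⊢
    by_contra hj
    exact absurd (hmono hij) (not_le.2 (hlt I hI _ hi _ hj))
  rw [← hmem, ← hcard]
  have hj := j.2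
  constructor
  · intro hjJ
    have := Finset.card_le_card (fun i hi => hup j i hjJ (Finset.mem_Ici.1 hi) :
      Finset.Ici j ⊆ J)
    rw [Fin.card_Ici] at this
    omega
  · intro hle
    by_contra hjJ
    have : J ⊆ Finset.Ioi j := fun i hi => Finset.mem_Ioi.2 (lt_of_not_ge fun hij =>
      hjJ (hup i j hi hij))
    have := Finset.card_le_card this
    rw [Fin.card_Ioi] at this
    omega

/-- A perturbation of the vertex with entries 1 below k and S_j from k on. The zeros of `ω` mark the
coordinates below k that equal 1; the zeros of `χ` at m ≥ k mark the tight final segments starting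
at m. -/
theorem exists_sum_eq_topSum_iff {b : Fin n → ℕ} (hb : ∀ i, 0 < b i) {k : ℕ} (hk : k ≤ n)
    (hkS : ∀ j : Fin n, j.val + 1 = k → 2 ≤ partialSum b j) (χ : ℕ → ℝ) (ω : Fin n → ℝ)
    (hχ : ∀ m, 0 ≤ χ m ∧ χ m ≤ 1) (hω : ∀ j, 0 ≤ ω j ∧ ω j ≤ 1) (hχk : χ k = 0) (hχn : χ n = 0) :
    ∃ y : Fin n → ℝ,
      (∀ J : Finset (Fin n), ∑ j ∈ J, y j ≤ topSum b J.card) ∧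
      (∀ J : Finset (Fin n), ∑ j ∈ J, y j = topSum b J.card ↔
        J = Finset.univ.filter (fun i : Fin n => n ≤ i.val + J.card) ∧ J.card + k ≤ n ∧
          χ (n - J.card) = 0) ∧
      (∀ j, 1 ≤ y j) ∧
      ∀ j, y j = 1 ↔ (j.val < k ∧ ω j = 0) ∨
        (k = 0 ∧ j.val = 0 ∧ partialSum b j = 1 ∧ χ 1 = 0) := by
  -- Chosen so that the total perturbation, at most n ε, stays below the integrality gap 1.
  set ε : ℝ := 1 / (n + 1) with hε
  have hε0 : 0 < ε := by positivity
  have hεn : n * ε < 1 := by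
    rw [hε, mul_one_div, div_lt_one (by positivity)]
    linarith
  have hεle : ∀ j : Fin n, ε < 1 := fun j => by
    have : (1 : ℝ) ≤ n := by exact_mod_cast Fin.pos j
    nlinarith
  have hS1 : ∀ j : Fin n, (j.val : ℝ) + 1 ≤ partialSum b j := fun j => by
    exact_mod_cast succ_le_partialSum hb j
  set y : Fin n → ℝ := fun j => if j.val < k then 1 + ε * ω j else
    partialSum b j - ε * (χ j.val - χ (j.val + 1)) with hy
  have hyle : ∀ j, y j ≤ partialSum b j + ε := by
    intro j
    simp only [hy]
    have h1 := hS1 j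
    have h2 := hω j
    have h3 := hχ j.val
    have h4 := hχ (j.val + 1)
    have h5 : (0 : ℝ) ≤ j.val := Nat.cast_nonneg _
    split_ifs <;> nlinarith
  have hsum : ∀ J : Finset (Fin n), ∑ j ∈ J, y j ≤ ∑ j ∈ J, (partialSum b j : ℝ) + n * ε := by
    intro J
    refine (Finset.sum_le_sum fun j _ => hyle j).trans ?_
    rw [Finset.sum_add_distrib, Finset.sum_const, nsmul_eq_mul]
    have : (J.card : ℝ) ≤ n := by
      have := Finset.card_le_univ J
      rw [Fintype.card_fin] at this
      exact_mod_cast this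
    nlinarith
  -- The differences of `χ` telescope, leaving the slack ε χ (n - c) because `χ n = 0`.
  have htel : ∀ c, c + k ≤ n →
      ∑ i : Fin n with n ≤ i.val + c, y i = topSum b c - ε * χ (n - c) := by
    intro c
    induction c with
    | zero =>
      intro _
      rw [topSum_zero, Finset.filter_false_of_mem, Finset.sum_empty, Nat.sub_zero, hχn]
      · simp
      · intro i _
        have := i.2
        omega
    | succ c ih =>
      intro hc
      rw [sum_filter_le_add_succ y (by omega), topSum_succ b (by omega : c < n), ih (by omega)]
      have h1 : ¬ n - c - 1 < k := by omega
      simp only [hy, h1, if_false]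
      rw [show n - c - 1 + 1 = n - c by omega, show n - (c + 1) = n - c - 1 by omega]
      ring
  have hlt : ∀ J : Finset (Fin n),
      ¬ (J = Finset.univ.filter (fun i : Fin n => n ≤ i.val + J.card) ∧ J.card + k ≤ n) →
      ∑ j ∈ J, y j < topSum b J.card := by
    intro J hJ
    rcases sum_partialSum_add_one_le_or hb J with h | h
    · have := hsum J
      linarith
    -- A final segment longer than n - k contains position k - 1, where the entry is at most 1 + ε
    -- although the partial sum is at least 2. This loss of 1 outweighs the perturbation.
    · have hck : ¬ J.card + k ≤ n := fun hck => hJ ⟨h, hck⟩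
      have hJn : J.card ≤ n := by
        have := Finset.card_le_univ J
        rwa [Fintype.card_fin] at this
      have hk1 : k - 1 < n := by omega
      have hmem : (⟨k - 1, hk1⟩ : Fin n) ∈ J := by
        rw [h]
        simp only [Finset.mem_filter, Finset.mem_univ, true_and]
        have := Finset.card_le_univ J
        rw [Fintype.card_fin] at this
        omega
      have h1 := hkS ⟨k - 1, hk1⟩ (by simp only; omega)
      have h2 : (2 : ℝ) ≤ partialSum b ⟨k - 1, hk1⟩ := by exact_mod_cast h1
      have h3 : y ⟨k - 1, hk1⟩ + 1 ≤ partialSum b ⟨k - 1, hk1⟩ + ε := by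
        have h4 : k - 1 < k := by omega
        have h5 := (hω ⟨k - 1, hk1⟩).2
        simp only [hy, h4, if_true]
        nlinarith
      have h4 : ∑ j ∈ J, (y j + if j = ⟨k - 1, hk1⟩ then 1 else 0) ≤
          ∑ j ∈ J, ((partialSum b j : ℝ) + ε) := by
        refine Finset.sum_le_sum fun j _ => ?_
        split_ifs with hj
        · rw [hj]
          exact h3
        · rw [add_zero]
          exact hyle j
      rw [Finset.sum_add_distrib, Finset.sum_add_distrib, Finset.sum_ite_eq' J, if_pos hmem,
        Finset.sum_const, nsmul_eq_mul] at h4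
      have h5 := sum_partialSum_le_topSum hb J
      have h6 : (J.card : ℝ) ≤ n := by exact_mod_cast hJn
      nlinarith
  refine ⟨y, fun J => ?_, fun J => ?_, fun j => ?_, fun j => ?_⟩
  · by_cases hJ : J = Finset.univ.filter (fun i : Fin n => n ≤ i.val + J.card) ∧ J.card + k ≤ n
    · conv_lhs => rw [hJ.1]
      rw [htel _ hJ.2]
      have := mul_nonneg hε0.le (hχ (n - J.card)).1
      linarith
    · exact (hlt J hJ).le
  · by_cases hJ : J = Finset.univ.filter (fun i : Fin n => n ≤ i.val + J.card) ∧ J.card + k ≤ n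
    · have h1 : ∑ j ∈ J, y j = topSum b J.card - ε * χ (n - J.card) := by
        conv_lhs => rw [hJ.1]
        exact htel _ hJ.2
      rw [h1, sub_eq_self, mul_eq_zero, or_iff_right hε0.ne', ← and_assoc]
      exact ⟨fun h => ⟨hJ, h⟩, fun h => h.2⟩
    · exact iff_of_false (hlt J hJ).ne fun h => hJ ⟨h.1, h.2.1⟩
  · have h1 := hS1 j
    have h3 := hχ j.val
    have h4 := hχ (j.val + 1)
    have hω := hω j
    have hε1 := hεle j
    simp only [hy]
    split_ifs with hjk
    · nlinarith
    · by_cases h0 : j.val = 0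
      · have : k = 0 := by omega
        rw [h0, ← this, hχk]
        rw [h0] at h1
        push_cast at h1
        have := hχ (k + 1)
        nlinarith
      · have : (1 : ℝ) ≤ j.val := by exact_mod_cast Nat.one_le_iff_ne_zero.2 h0
        nlinarith
  · have h1 := hS1 j
    have h3 := hχ j.val
    have h4 := hχ (j.val + 1)
    have hε1 := hεle j
    by_cases hjk : j.val < k
    · simp only [hy, hjk, if_true, true_and]
      rw [add_eq_left, mul_eq_zero, or_iff_right hε0.ne']
      exact ⟨Or.inl, fun h => h.resolve_right (by omega)⟩
    · simp only [hy, hjk, if_false, false_and, false_or]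
      -- From position 1 on, S_j ≥ 2 keeps the entry above 1. At position 0 the entry is S_0 + ε χ
      -- 1, as `χ 0 = χ k = 0`.
      by_cases h0 : j.val = 0
      · have hk0 : k = 0 := by omega
        rw [hk0] at hχk
        simp only [h0, hk0, hχk, true_and, zero_add, zero_sub, mul_neg, sub_neg_eq_add]
        rw [h0] at h1
        push_cast at h1
        rw [h0] at h4
        have h5 := mul_nonneg hε0.le h4.1
        constructor
        · intro h
          have h6 : ε * χ 1 = 0 := le_antisymm (by linarith) h5
          refine ⟨?_, (mul_eq_zero.1 h6).resolve_left hε0.ne'⟩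
          rw [h6, add_zero] at h
          exact_mod_cast h
        · rintro ⟨h, h'⟩
          rw [h, h']
          simp
      · have : (1 : ℝ) ≤ j.val := by exact_mod_cast Nat.one_le_iff_ne_zero.2 h0
        refine iff_of_false (fun h => ?_) fun h => h0 h.2.1
        nlinarith

/-- A chain of subsets of `Fin n` that contains `∅` is the collection of the subsets `I` whose
inequalities are tight at some point of the polytope, and outside of the members of the chain the
set of coordinates that are equal to `1` at that point can be prescribed. -/
theorem exists_mem_parkingPolytope_tight_iff {b : Fin n → ℕ} (hb : ∀ i, 0 < b i) (hn : 0 < n)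
    (C : Finset (Finset (Fin n))) (hC : ∀ I ∈ C, ∀ J ∈ C, I ⊆ J ∨ J ⊆ I) (h0 : ∅ ∈ C)
    (hone : b ⟨0, hn⟩ = 1 → ∀ I ∈ C, I.card + 1 = n → Finset.univ ∈ C) (A : Set (Fin n)) :
    ∃ x ∈ parkingPolytope b,
      (∀ I : Finset (Fin n), ∑ i ∈ I, x i = topSum b I.card ↔ I ∈ C) ∧
      (∀ i, (∀ I ∈ C, i ∉ I) → (x i = 1 ↔ i ∈ A)) ∧
      ∀ i, (∃ I ∈ C, i ∈ I) →
        (x i = 1 ↔ b ⟨0, hn⟩ = 1 ∧ Finset.univ ∈ C ∧ Finset.univ.erase i ∈ C) := by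
  classical
  obtain ⟨σ, hσ⟩ := exists_perm_mem_iff_of_chain C hC
  obtain ⟨K, hKC, hKmax⟩ := Finset.exists_max_image C Finset.card ⟨_, h0⟩
  have hcardle : ∀ I : Finset (Fin n), I.card ≤ n := fun I => by
    simpa using Finset.card_le_univ I
  have hK := hcardle K
  -- The largest member K fills the positions from k = n - |K| on, and `χ m` vanishes iff the chain
  -- has a member of size n - m. If S at position k - 1 were 1, then b_1 = 1 and |K| = n - 1, so
  -- `hone` would put the full set in C, against the maximality of K.
  obtain ⟨y, hy1, hy2, hy3, hy4⟩ := exists_sum_eq_topSum_iff hb (k := n - K.card) (by omega) (by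
      intro j hj
      have h1 := succ_le_partialSum hb j
      by_contra hlt
      have hj0 : j = ⟨0, hn⟩ := Fin.ext (by simp only; omega)
      have h2 : b ⟨0, hn⟩ = 1 := by
        rw [← partialSum_zero b hn, ← hj0]
        omega
      have h3 := hKmax _ (hone h2 K hKC (by rw [hj0] at hj; simp only at hj; omega))
      rw [Finset.card_univ, Fintype.card_fin] at h3
      omega)
    (fun m => if ∃ I ∈ C, I.card + m = n then 0 else 1) (fun j => if σ j ∈ A then 0 else 1)
    (fun m => by split_ifs <;> norm_num) (fun j => by split_ifs <;> norm_num)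
    (by
      rw [if_pos]
      exact ⟨K, hKC, by omega⟩)
    (by
      rw [if_pos]
      exact ⟨∅, h0, by simp⟩)
  have hsum : ∀ I : Finset (Fin n), ∑ i ∈ I, y (σ.symm i) =
      ∑ j ∈ I.map σ.symm.toEmbedding, y j := fun I => by simp [Finset.sum_map]
  have hmem : ∀ (I : Finset (Fin n)) j, j ∈ I.map σ.symm.toEmbedding ↔ σ j ∈ I :=
    fun I j => by simp
  have hunion : ∀ i, (∃ I ∈ C, i ∈ I) ↔ n - K.card ≤ (σ.symm i).val := by
    intro i
    constructor
    · rintro ⟨I, hI, hi⟩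
      have h1 := (hσ I hI (σ.symm i)).1 (by simpa using hi)
      have := hKmax I hI
      omega
    · intro h
      refine ⟨K, hKC, ?_⟩
      have := (hσ K hKC (σ.symm i)).2 (by omega)
      simpa using this
  refine ⟨fun i => y (σ.symm i), (mem_parkingPolytope_iff hb _).2 ⟨fun i => hy3 _, fun I => ?_⟩,
    fun I => ?_, fun i hi => ?_, fun i hi => ?_⟩
  · rw [hsum]
    simpa using hy1 (I.map σ.symm.toEmbedding)
  · have h := hy2 (I.map σ.symm.toEmbedding)
    rw [Finset.card_map] at h
    rw [hsum, h]
    constructor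
    · rintro ⟨h1, -, h3⟩
      have h4 : ∃ J ∈ C, J.card + (n - I.card) = n := by
        by_contra h4
        rw [if_neg h4] at h3
        exact one_ne_zero h3
      obtain ⟨J, hJ, hcard⟩ := h4
      have := hcardle I
      have hIJ : I = J := by
        ext i
        have h5 := hσ J hJ (σ.symm i)
        have h6 := hmem I (σ.symm i)
        rw [h1, Finset.mem_filter] at h6
        simp only [Finset.mem_univ, true_and, Equiv.apply_symm_apply] at h5 h6
        rw [← h6, h5, show J.card = I.card by omega]
      rwa [hIJ]
    · intro hI
      have h1 := hKmax I hI
      refine ⟨?_, by omega, ?_⟩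
      · ext j
        rw [hmem, hσ I hI]
        simp
      · rw [if_pos]
        exact ⟨I, hI, by have := hcardle I; omega⟩
  · have hi' : (σ.symm i).val < n - K.card := by
      rw [← not_le, ← hunion]
      rintro ⟨I, hI, h⟩
      exact hi I hI h
    rw [hy4]
    constructor
    · rintro (⟨-, h⟩ | ⟨h, -⟩)
      · by_contra hA
        rw [if_neg (by simpa using hA)] at h
        exact one_ne_zero h
      · omega
    · intro hA
      exact Or.inl ⟨hi', if_pos (by simpa using hA)⟩
  · rw [hunion] at hi
    have hKuniv : n - K.card = 0 ↔ Finset.univ ∈ C := by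
      constructor
      · intro h
        have : K = Finset.univ := by
          rw [← Finset.card_eq_iff_eq_univ, Fintype.card_fin]
          omega
        rwa [← this]
      · intro h
        have := hKmax _ h
        rw [Finset.card_univ, Fintype.card_fin] at this
        omega
    rw [hy4, or_iff_right (by omega)]
    constructor
    · rintro ⟨h1, h2, h3, h4⟩
      have hj : σ.symm i = ⟨0, hn⟩ := Fin.ext h2
      rw [hj, partialSum_zero] at h3
      refine ⟨h3, hKuniv.1 h1, ?_⟩
      have h5 : ∃ J ∈ C, J.card + 1 = n := by
        by_contra h5
        rw [if_neg h5] at h4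
        exact one_ne_zero h4
      obtain ⟨J, hJ, hcard⟩ := h5
      have hiJ : i ∉ J := fun hiJ => by
        have := (hσ J hJ (σ.symm i)).1 (by simpa using hiJ)
        omega
      have : J = Finset.univ.erase i := Finset.eq_of_subset_of_card_le
        (fun j hj => Finset.mem_erase.2 ⟨fun h => hiJ (h ▸ hj), Finset.mem_univ _⟩)
        (by rw [Finset.card_erase_of_mem (Finset.mem_univ _), Finset.card_univ,
              Fintype.card_fin]; omega)
      rwa [← this]
    · rintro ⟨h1, h2, h3⟩
      have hcard : (Finset.univ.erase i).card + 1 = n := by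
        rw [Finset.card_erase_add_one (Finset.mem_univ _), Finset.card_univ, Fintype.card_fin]
      have h4 := (hσ _ h3 (σ.symm i)).not.1 (by simp)
      have h5 : (σ.symm i).val = 0 := by omega
      refine ⟨hKuniv.2 h2, h5, ?_, if_pos ⟨_, h3, hcard⟩⟩
      rw [show σ.symm i = ⟨0, hn⟩ from Fin.ext h5, partialSum_zero, h1]

end Existence

/-! ### Nested sets of the building sets -/

section Nested

variable {n : ℕ}

/-- The set `([n] \ I) ∪ {n+1}`. -/
def coneCompl (I : Finset (Fin n)) : Finset (Fin (n + 1)) :=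
  insert (Fin.last n) (Iᶜ.map Fin.castSuccEmb)

@[simp] theorem last_mem_coneCompl (I : Finset (Fin n)) : Fin.last n ∈ coneCompl I :=
  Finset.mem_insert_self _ _

@[simp] theorem castSucc_mem_coneCompl {I : Finset (Fin n)} {i : Fin n} :
    i.castSucc ∈ coneCompl I ↔ i ∉ I := by
  simp [coneCompl]

theorem coneCompl_subset_coneCompl {I J : Finset (Fin n)} :
    coneCompl I ⊆ coneCompl J ↔ J ⊆ I := by
  constructor
  · intro h i hi
    by_contra hiI
    exact castSucc_mem_coneCompl.1 (h (castSucc_mem_coneCompl.2 hiI)) hi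
  · intro h x hx
    induction x using Fin.lastCases with
    | last => simp
    | cast i => exact castSucc_mem_coneCompl.2 fun hi => castSucc_mem_coneCompl.1 hx (h hi)

theorem coneCompl_injective : Function.Injective (coneCompl (n := n)) := fun _ _ h =>
  Finset.Subset.antisymm (coneCompl_subset_coneCompl.1 h.ge) (coneCompl_subset_coneCompl.1 h.le)

@[simp] theorem coneCompl_inj {I J : Finset (Fin n)} : coneCompl I = coneCompl J ↔ I = J :=
  coneCompl_injective.eq_iff

theorem coneCompl_empty : coneCompl (∅ : Finset (Fin n)) = Finset.univ := by
  ext x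
  induction x using Fin.lastCases with
  | last => simp
  | cast i => simp

@[simp] theorem singleton_castSucc_ne_coneCompl (i : Fin n) (I : Finset (Fin n)) :
    ({i.castSucc} : Finset (Fin (n + 1))) ≠ coneCompl I := fun h => by
  have := last_mem_coneCompl I
  rw [← h, Finset.mem_singleton] at this
  exact i.castSucc_ne_last this.symm

theorem insert_last_eq_coneCompl (S : Finset (Fin n)) :
    insert (Fin.last n) (S.map Fin.castSuccEmb) = coneCompl Sᶜ := by
  rw [coneCompl, compl_compl]

/-- The members of `B` are the sets `{i}` and `S ∪ {n+1}` for `i ∈ [n]` and `S ⊆ [n]`, where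
`|S| = 1` is excluded if `p` holds. -/
def IsParkingBuildingSet (p : Prop) (B : BuildingSet (Fin (n + 1))) : Prop :=
  ∀ J, J ∈ B.sets ↔ (∃ i : Fin n, J = {i.castSucc}) ∨
    ∃ I : Finset (Fin n), (p → Iᶜ.card ≠ 1) ∧ J = coneCompl I

theorem isParkingBuildingSet_ite (p : Prop) [Decidable p] :
    IsParkingBuildingSet p (if p then buildingSetPF n else buildingSetSt n) := by
  intro J
  split_ifs with hp
  · refine or_congr Iff.rfl ⟨?_, ?_⟩
    · rintro ⟨S, hS, rfl⟩
      exact ⟨Sᶜ, fun _ => by rwa [compl_compl], insert_last_eq_coneCompl S⟩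
    · rintro ⟨I, hI, rfl⟩
      exact ⟨Iᶜ, hI hp, rfl⟩
  · refine or_congr Iff.rfl ⟨?_, ?_⟩
    · rintro ⟨S, rfl⟩
      exact ⟨Sᶜ, fun h => absurd h hp, insert_last_eq_coneCompl S⟩
    · rintro ⟨I, -, rfl⟩
      exact ⟨Iᶜ, rfl⟩

variable {p : Prop} {B : BuildingSet (Fin (n + 1))}

/-- The full set is `coneCompl ∅`, whose S has n elements; it would be missing only in the
degenerate case n = 1 = b_1. -/
theorem IsParkingBuildingSet.maxSets_eq (hB : IsParkingBuildingSet p B) (hp : p → n ≠ 1) :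
    B.maxSets = {Finset.univ} := by
  have huniv : Finset.univ ∈ B.sets :=
    (hB _).2 (Or.inr ⟨∅, fun h => by simpa using hp h, coneCompl_empty.symm⟩)
  ext J
  rw [BuildingSet.maxSets, Set.mem_ofPred_eq, Set.mem_singleton_iff]
  constructor
  · intro h
    exact Finset.univ_subset_iff.1 (h.2 huniv (Finset.subset_univ _))
  · rintro rfl
    exact ⟨huniv, fun _ _ _ => Finset.subset_univ _⟩

theorem IsParkingBuildingSet.mem_diff_maxSets (hB : IsParkingBuildingSet p B) (hp : p → n ≠ 1)
    (J : Finset (Fin (n + 1))) : J ∈ B.sets \ B.maxSets ↔ (∃ i : Fin n, J = {i.castSucc}) ∨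
      ∃ I : Finset (Fin n), I.Nonempty ∧ (p → Iᶜ.card ≠ 1) ∧ J = coneCompl I := by
  rw [Set.mem_sdiff, hB, hB.maxSets_eq hp, Set.mem_singleton_iff, ← coneCompl_empty]
  constructor
  · rintro ⟨⟨i, rfl⟩ | ⟨I, hI, rfl⟩, hJ⟩
    · exact Or.inl ⟨i, rfl⟩
    · refine Or.inr ⟨I, Finset.nonempty_iff_ne_empty.2 fun h => hJ (by rw [h]), hI, rfl⟩
  · rintro (⟨i, rfl⟩ | ⟨I, hI, h, rfl⟩)
    · exact ⟨Or.inl ⟨i, rfl⟩, singleton_castSucc_ne_coneCompl i _⟩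
    · exact ⟨Or.inr ⟨I, h, rfl⟩, fun h => hI.ne_empty (coneCompl_injective h)⟩

/-- Two sets containing n + 1 are never disjoint, so they must be nested. A disjoint union with {i}
removes i from I, which leaves the building set only if it creates the excluded size |S| = 1; two
distinct singletons together with {n+1} give size 2, which is never excluded. -/
theorem IsParkingBuildingSet.isNested_iff (hB : IsParkingBuildingSet p B) (hp : p → n ≠ 1)
    (N : Finset (Finset (Fin (n + 1)))) : B.IsNested N ↔
      (N : Set (Finset (Fin (n + 1)))) ⊆ B.sets \ B.maxSets ∧
      (∀ I J, coneCompl I ∈ N → coneCompl J ∈ N → I ⊆ J ∨ J ⊆ I) ∧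
      (∀ (i : Fin n) I, {i.castSucc} ∈ N → coneCompl I ∈ N → i ∈ I → p ∧ I = Finset.univ) ∧
      ∀ i j : Fin n, {i.castSucc} ∈ N → {j.castSucc} ∈ N → coneCompl Finset.univ ∈ N → i = j := by
  classical
  constructor
  · intro hN
    refine ⟨hN.subset, fun I J hI hJ => ?_, fun i I hi hI hiI => ?_, fun i j hi hj hu => ?_⟩
    · rcases hN.laminar _ hI _ hJ with h | h | h
      · exact Or.inr (coneCompl_subset_coneCompl.1 h)
      · exact Or.inl (coneCompl_subset_coneCompl.1 h)
      · exact absurd (last_mem_coneCompl J)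
          (Finset.disjoint_left.1 h (last_mem_coneCompl I))
    · have hdisj : Disjoint ({i.castSucc} : Finset (Fin (n + 1))) (coneCompl I) := by
        simpa using hiI
      have h := hN.union_notMem {{i.castSucc}, coneCompl I} (by
          intro J
          simp only [Finset.mem_insert, Finset.mem_singleton]
          rintro (rfl | rfl)
          · exact hi
          · exact hI)
        (by rw [Finset.card_pair (singleton_castSucc_ne_coneCompl i I)])
        (by
          intro J hJ K hK hJK
          simp only [Finset.mem_insert, Finset.mem_singleton] at hJ hK
          rcases hJ with rfl | rfl <;> rcases hK with rfl | rfl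
          · exact absurd rfl hJK
          · exact hdisj
          · exact hdisj.symm
          · exact absurd rfl hJK)
      have hun : (({{i.castSucc}, coneCompl I} : Finset (Finset (Fin (n + 1)))).biUnion id) =
          coneCompl (I.erase i) := by
        ext x
        induction x using Fin.lastCases with
        | last => simp
        | cast k =>
          simp only [Finset.biUnion_insert, Finset.singleton_biUnion, id, Finset.mem_union,
            Finset.mem_singleton, castSucc_mem_coneCompl, Finset.mem_erase, Fin.castSucc_inj]
          tauto
      rw [hun, hB] at h
      push Not at h
      by_cases hpp : p
      · refine ⟨hpp, ?_⟩
        by_contra hI'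
        refine h.2 _ (fun _ hcard => hI' ?_) rfl
        have h1 := Finset.card_add_card_compl (I.erase i)
        have h2 := Finset.card_erase_add_one hiI
        rw [← Finset.card_eq_iff_eq_univ]
        omega
      · exact absurd rfl (h.2 _ (fun h => absurd h hpp))
    · by_contra hij
      have h := hN.union_notMem {{i.castSucc}, {j.castSucc}, coneCompl Finset.univ} (by
          intro J
          simp only [Finset.mem_insert, Finset.mem_singleton]
          rintro (rfl | rfl | rfl)
          · exact hi
          · exact hj
          · exact hu)
        (by
          rw [Finset.card_insert_of_notMem (by simpa using hij),
            Finset.card_pair (singleton_castSucc_ne_coneCompl j _)]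
          omega)
        (by
          intro J hJ K hK hJK
          simp only [Finset.mem_insert, Finset.mem_singleton] at hJ hK
          rcases hJ with rfl | rfl | rfl <;> rcases hK with rfl | rfl | rfl <;>
            first
            | exact absurd rfl hJK
            | simp [hij, Ne.symm hij])
      have hun : (({{i.castSucc}, {j.castSucc}, coneCompl Finset.univ} :
          Finset (Finset (Fin (n + 1)))).biUnion id) =
          coneCompl ({i, j} : Finset (Fin n))ᶜ := by
        ext x
        induction x using Fin.lastCases with
        | last => simp
        | cast k =>
          simp only [Finset.biUnion_insert, Finset.singleton_biUnion, id, Finset.mem_union,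
            Finset.mem_singleton, castSucc_mem_coneCompl, Finset.mem_univ, not_true_eq_false,
            or_false, Fin.castSucc_inj, Finset.mem_compl, Finset.mem_insert, not_not]
      rw [hun, hB] at h
      push Not at h
      refine h.2 _ (fun _ hcard => ?_) rfl
      rw [compl_compl, Finset.card_pair hij] at hcard
      omega
  · rintro ⟨hsub, h1, h2, h3⟩
    have hform : ∀ J ∈ N, (∃ i : Fin n, J = {i.castSucc}) ∨
        ∃ I : Finset (Fin n), J = coneCompl I := by
      intro J hJ
      rcases (hB.mem_diff_maxSets hp J).1 (hsub hJ) with h | ⟨I, -, -, h⟩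
      · exact Or.inl h
      · exact Or.inr ⟨I, h⟩
    refine ⟨hsub, fun J hJ K hK => ?_, fun M hM hcard hdisj hmem => ?_⟩
    · rcases hform J hJ with ⟨i, rfl⟩ | ⟨I, rfl⟩
      · by_cases hi : i.castSucc ∈ K
        · exact Or.inl (by simpa using hi)
        · exact Or.inr (Or.inr (by simpa using hi))
      · rcases hform K hK with ⟨i, rfl⟩ | ⟨I', rfl⟩
        · by_cases hi : i.castSucc ∈ coneCompl I
          · exact Or.inr (Or.inl (by simpa using hi))
          · exact Or.inr (Or.inr (by simpa using hi))
        · rw [coneCompl_subset_coneCompl, coneCompl_subset_coneCompl]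
          rcases h1 I I' hJ hK with h | h
          · exact Or.inr (Or.inl h)
          · exact Or.inl h
    · rcases (hB _).1 hmem with ⟨i, hi⟩ | ⟨K, hK, hKeq⟩
      · have : M ⊆ {{i.castSucc}} := by
          intro J hJ
          rw [Finset.mem_singleton]
          have hle : J ⊆ {i.castSucc} := by
            rw [← hi]
            exact Finset.subset_biUnion_of_mem id hJ
          exact (Finset.subset_singleton_iff.1 hle).resolve_left
            (B.nonempty_of_mem _ (hsub (hM hJ)).1).ne_empty
        have := Finset.card_le_card this
        rw [Finset.card_singleton] at this
        omega
      -- The only member of M containing n + 1 is `coneCompl I`; the others are singletons of points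
      -- of I. Then I is everything and the singletons coincide, so the union is {i, n+1}, which is
      -- excluded.
      · have hlast := last_mem_coneCompl K
        rw [← hKeq, Finset.mem_biUnion] at hlast
        obtain ⟨J, hJM, hJ⟩ := hlast
        obtain ⟨I, rfl⟩ : ∃ I, J = coneCompl I := by
          rcases hform J (hM hJM) with ⟨i, rfl⟩ | h
          · exact absurd (Finset.mem_singleton.1 hJ).symm i.castSucc_ne_last
          · exact h
        have hother : ∀ J' ∈ M, J' ≠ coneCompl I → ∃ i : Fin n, J' = {i.castSucc} ∧ i ∈ I := by
          intro J' hJ' hne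
          have hd := hdisj _ hJ' _ hJM hne
          rcases hform J' (hM hJ') with ⟨i, rfl⟩ | ⟨I', rfl⟩
          · exact ⟨i, rfl, by simpa using hd⟩
          · exact absurd (last_mem_coneCompl I)
              (Finset.disjoint_left.1 hd (last_mem_coneCompl I'))
        obtain ⟨J', hJ', hne⟩ := Finset.exists_mem_ne hcard (coneCompl I)
        obtain ⟨i, rfl, hiI⟩ := hother J' hJ' hne
        obtain ⟨hpp, rfl⟩ := h2 i I (hM hJ') (hM hJM) hiI
        refine hK hpp (Finset.card_eq_one.2 ⟨i, ?_⟩)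
        ext j
        rw [Finset.mem_compl, Finset.mem_singleton, ← castSucc_mem_coneCompl, ← hKeq,
          Finset.mem_biUnion]
        constructor
        · rintro ⟨L, hL, hj⟩
          by_cases hLu : L = coneCompl Finset.univ
          · rw [hLu] at hj
            simp at hj
          · obtain ⟨k, rfl, -⟩ := hother L hL hLu
            have hjk : j = k := by simpa using hj
            rw [hjk]
            exact h3 k i (hM hL) (hM hJ') (hM hJM)
        · rintro rfl
          exact ⟨_, hJ', by simp⟩

end Nested

/-! ### Faces of the parking-function polytope -/

section Faces

variable {n : ℕ} {b : Fin n → ℕ} {B : BuildingSet (Fin (n + 1))}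

theorem mem_facetOf_singleton {i : Fin n} {x : Fin n → ℝ} :
    x ∈ facetOf b {i.castSucc} ↔ x ∈ parkingPolytope b ∧ x i = 1 := by
  have : Fin.last n ∉ ({i.castSucc} : Finset (Fin (n + 1))) := fun h =>
    i.castSucc_ne_last (Finset.mem_singleton.1 h).symm
  simp [facetOf, this, lowerFacet]

theorem mem_facetOf_coneCompl {I : Finset (Fin n)} {x : Fin n → ℝ} :
    x ∈ facetOf b (coneCompl I) ↔
      x ∈ parkingPolytope b ∧ ∑ i ∈ I, x i = topSum b I.card := by
  have : (Finset.univ.filter fun i : Fin n => i.castSucc ∉ coneCompl I) = I := by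
    ext i
    simp
  rw [facetOf, if_pos (last_mem_coneCompl I), this]
  rfl

theorem IsParkingBuildingSet.isNested_of_tight {hn : 0 < n}
    (hB : IsParkingBuildingSet (b ⟨0, hn⟩ = 1) B) (hp : b ⟨0, hn⟩ = 1 → n ≠ 1)
    (hb : ∀ i, 0 < b i) {x : Fin n → ℝ} (hx : x ∈ parkingPolytope b)
    {N : Finset (Finset (Fin (n + 1)))}
    (hN : ∀ J ∈ N, J ∈ B.sets \ B.maxSets ∧ x ∈ facetOf b J) : B.IsNested N := by
  rw [hB.isNested_iff hp]
  refine ⟨fun J hJ => (hN J hJ).1, fun I J hI hJ => ?_, fun i I hi hI hiI => ?_,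
    fun i j hi hj hu => ?_⟩
  · exact subset_or_subset_of_tight hb hx (mem_facetOf_coneCompl.1 (hN _ hI).2).2
      (mem_facetOf_coneCompl.1 (hN _ hJ).2).2
  · exact (eq_univ_of_tight_of_eq_one hb hx (mem_facetOf_coneCompl.1 (hN _ hI).2).2 hiI
      (mem_facetOf_singleton.1 (hN _ hi).2).2 hn).1
  · exact eq_of_tight_univ_of_eq_one hb hx (mem_facetOf_coneCompl.1 (hN _ hu).2).2
      (mem_facetOf_singleton.1 (hN _ hi).2).2 (mem_facetOf_singleton.1 (hN _ hj).2).2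

/-- Such a point behaves like a relative interior point of ℱ_N: it recovers N from the face. -/
theorem IsParkingBuildingSet.exists_mem_facetOf_iff {hn : 0 < n}
    (hB : IsParkingBuildingSet (b ⟨0, hn⟩ = 1) B) (hp : b ⟨0, hn⟩ = 1 → n ≠ 1)
    (hb : ∀ i, 0 < b i) {N : Finset (Finset (Fin (n + 1)))} (hN : B.IsNested N) :
    ∃ x ∈ parkingPolytope b, ∀ J ∈ B.sets \ B.maxSets, x ∈ facetOf b J ↔ J ∈ N := by
  classical
  obtain ⟨hsub, h1, h2, h3⟩ := (hB.isNested_iff hp N).1 hN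
  have hproper : ∀ I, coneCompl I ∈ N → b ⟨0, hn⟩ = 1 → Iᶜ.card ≠ 1 := by
    intro I hI
    rcases (hB.mem_diff_maxSets hp _).1 (hsub hI) with ⟨i, h⟩ | ⟨I', -, h, h'⟩
    · exact absurd h.symm (singleton_castSucc_ne_coneCompl i I)
    · rwa [coneCompl_inj.1 h']
  have hcompl : ∀ I : Finset (Fin n), I.card + Iᶜ.card = n := fun I => by
    simp
  have herase : ∀ i : Fin n, ((Finset.univ.erase i)ᶜ).card = 1 := fun i => by simp
  set T : Finset (Finset (Fin n)) := Finset.univ.filter fun I => coneCompl I ∈ N with hT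
  have hmemT : ∀ I, I ∈ T ↔ coneCompl I ∈ N := fun I => by simp [hT]
  set A : Set (Fin n) := {i | {i.castSucc} ∈ N} with hA
  suffices h : ∃ x ∈ parkingPolytope b,
      (∀ I : Finset (Fin n), I.Nonempty → (b ⟨0, hn⟩ = 1 → Iᶜ.card ≠ 1) →
        (∑ i ∈ I, x i = topSum b I.card ↔ coneCompl I ∈ N)) ∧
      ∀ i, x i = 1 ↔ {i.castSucc} ∈ N by
    obtain ⟨x, hx, hx1, hx2⟩ := h
    refine ⟨x, hx, fun J hJ => ?_⟩
    rcases (hB.mem_diff_maxSets hp J).1 hJ with ⟨i, rfl⟩ | ⟨I, hI, hI', rfl⟩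
    · rw [mem_facetOf_singleton, and_iff_right hx, hx2]
    · rw [mem_facetOf_coneCompl, and_iff_right hx, hx1 I hI hI']
  -- If N contains {i₀} and {n+1}, then b_1 = 1 and [n] \ {i₀} is forced to be tight although it
  -- indexes no facet. It must be added to the chain, and it is what makes coordinate i₀, and no
  -- other, equal to 1.
  by_cases hspecial : ∃ i : Fin n, {i.castSucc} ∈ N ∧ coneCompl Finset.univ ∈ N
  · obtain ⟨i₀, hi₀, huniv⟩ := hspecial
    have hb1 := (h2 i₀ _ hi₀ huniv (Finset.mem_univ _)).1
    have hsubT : ∀ I ∈ T, I ⊆ Finset.univ.erase i₀ ∨ Finset.univ.erase i₀ ⊆ I := by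
      intro I hI
      by_cases hi : i₀ ∈ I
      · rw [(h2 i₀ I hi₀ ((hmemT I).1 hI) hi).2]
        exact Or.inr (Finset.subset_univ _)
      · exact Or.inl fun j hj => Finset.mem_erase.2 ⟨fun h => hi (h ▸ hj), Finset.mem_univ _⟩
    have hunivC : Finset.univ ∈ insert ∅ (insert (Finset.univ.erase i₀) T) := by
      simp [hmemT, huniv]
    obtain ⟨x, hx, hx1, -, hx3⟩ := exists_mem_parkingPolytope_tight_iff hb hn
      (insert ∅ (insert (Finset.univ.erase i₀) T)) (by
        intro I hI J hJ
        simp only [Finset.mem_insert] at hI hJ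
        rcases hI with rfl | rfl | hI
        · exact Or.inl (Finset.empty_subset _)
        · rcases hJ with rfl | rfl | hJ
          · exact Or.inr (Finset.empty_subset _)
          · exact Or.inl subset_rfl
          · exact (hsubT J hJ).symm
        · rcases hJ with rfl | rfl | hJ
          · exact Or.inr (Finset.empty_subset _)
          · exact hsubT I hI
          · exact h1 I J ((hmemT I).1 hI) ((hmemT J).1 hJ))
      (Finset.mem_insert_self _ _) (fun _ _ _ _ => hunivC) A
    refine ⟨x, hx, fun I hI hI' => ?_, fun i => ?_⟩
    · rw [hx1, Finset.mem_insert, or_iff_right hI.ne_empty, Finset.mem_insert, or_iff_right, hmemT]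
      rintro rfl
      exact hI' hb1 (herase i₀)
    · rw [hx3 i ⟨_, hunivC, Finset.mem_univ i⟩, and_iff_right hb1, and_iff_right hunivC,
        Finset.mem_insert, or_iff_right, Finset.mem_insert, or_iff_left]
      · constructor
        · intro h
          have : i = i₀ := by
            by_contra hne
            have : i ∈ Finset.univ.erase i := by
              rw [h]
              exact Finset.mem_erase.2 ⟨hne, Finset.mem_univ _⟩
            exact Finset.notMem_erase _ _ this
          rwa [this]
        · intro h
          rw [h3 i i₀ h hi₀ huniv]
      · exact fun h => hproper _ ((hmemT _).1 h) hb1 (herase i)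
      · intro h
        have h4 := hcompl (Finset.univ.erase i)
        rw [herase, h, Finset.card_empty] at h4
        exact hp hb1 h4.symm
  · push Not at hspecial
    have hnotmem : b ⟨0, hn⟩ = 1 → ∀ I ∈ insert ∅ T, I.card + 1 ≠ n := by
      intro hb1 I hI hcard
      have h4 := hcompl I
      rcases Finset.mem_insert.1 hI with rfl | hI
      · exact hp hb1 (by simpa using hcard.symm)
      · exact hproper I ((hmemT I).1 hI) hb1 (by omega)
    obtain ⟨x, hx, hx1, hx2, hx3⟩ := exists_mem_parkingPolytope_tight_iff hb hn (insert ∅ T) (by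
        intro I hI J hJ
        simp only [Finset.mem_insert] at hI hJ
        rcases hI with rfl | hI
        · exact Or.inl (Finset.empty_subset _)
        · rcases hJ with rfl | hJ
          · exact Or.inr (Finset.empty_subset _)
          · exact h1 I J ((hmemT I).1 hI) ((hmemT J).1 hJ))
      (Finset.mem_insert_self _ _) (fun hb1 I hI hcard => absurd hcard (hnotmem hb1 I hI)) A
    refine ⟨x, hx, fun I hI hI' => ?_, fun i => ?_⟩
    · rw [hx1, Finset.mem_insert, or_iff_right hI.ne_empty, hmemT]
    · by_cases hi : ∃ I ∈ insert ∅ T, i ∈ I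
      · rw [hx3 i hi]
        refine iff_of_false (fun h => hnotmem h.1 _ h.2.2 ?_) fun hiN => ?_
        · rw [Finset.card_erase_add_one (Finset.mem_univ _), Finset.card_univ, Fintype.card_fin]
        · obtain ⟨I, hI, hiI⟩ := hi
          rcases Finset.mem_insert.1 hI with rfl | hI
          · exact Finset.notMem_empty _ hiI
          · have hIN := (hmemT I).1 hI
            refine hspecial i hiN ?_
            rwa [← (h2 i I hiN hIN hiI).2]
      · push Not at hi
        exact hx2 i hi

theorem facetOf_subset_parkingPolytope {hn : 0 < n}
    (hB : IsParkingBuildingSet (b ⟨0, hn⟩ = 1) B) (hp : b ⟨0, hn⟩ = 1 → n ≠ 1)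
    {J : Finset (Fin (n + 1))} (hJ : J ∈ B.sets \ B.maxSets) : facetOf b J ⊆ parkingPolytope b := by
  intro x hx
  rcases (hB.mem_diff_maxSets hp J).1 hJ with ⟨i, rfl⟩ | ⟨I, -, -, rfl⟩
  · exact (mem_facetOf_singleton.1 hx).1
  · exact (mem_facetOf_coneCompl.1 hx).1

theorem isExposed_setOf_eq_of_le {E : Type*} [AddCommGroup E] [Module ℝ E] [TopologicalSpace E]
    {P : Set E} (l : E →L[ℝ] ℝ) {c : ℝ} (h : ∀ x ∈ P, l x ≤ c) :
    IsExposed ℝ P {x ∈ P | l x = c} := by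
  rintro ⟨z, hz, hzc⟩
  refine ⟨l, Set.ext fun x => ⟨fun hx => ⟨hx.1, fun y hy => (h y hy).trans hx.2.ge⟩,
    fun hx => ⟨hx.1, le_antisymm (h x hx.1) ?_⟩⟩⟩
  rw [← hzc]
  exact hx.2 z hz

theorem isExposed_facetOf {hn : 0 < n}
    (hB : IsParkingBuildingSet (b ⟨0, hn⟩ = 1) B) (hp : b ⟨0, hn⟩ = 1 → n ≠ 1) (hb : ∀ i, 0 < b i)
    {J : Finset (Fin (n + 1))} (hJ : J ∈ B.sets \ B.maxSets) :
    IsExposed ℝ (parkingPolytope b) (facetOf b J) := by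
  rcases (hB.mem_diff_maxSets hp J).1 hJ with ⟨i, rfl⟩ | ⟨I, -, -, rfl⟩
  · have h := isExposed_setOf_eq_of_le (P := parkingPolytope b) (c := -1)
      (-ContinuousLinearMap.proj (R := ℝ) (φ := fun _ : Fin n => ℝ) i) fun x hx => by
        simpa using ((mem_parkingPolytope_iff hb x).1 hx).1 i
    have heq : facetOf b {i.castSucc} = {x ∈ parkingPolytope b |
        (-ContinuousLinearMap.proj (R := ℝ) (φ := fun _ : Fin n => ℝ) i) x = -1} := by
      ext x
      simp [mem_facetOf_singleton]
    rwa [heq]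
  · have h := isExposed_setOf_eq_of_le (P := parkingPolytope b) (c := topSum b I.card)
      (∑ i ∈ I, ContinuousLinearMap.proj (R := ℝ) (φ := fun _ : Fin n => ℝ) i) fun x hx => by
        simpa using ((mem_parkingPolytope_iff hb x).1 hx).2 I
    have heq : facetOf b (coneCompl I) = {x ∈ parkingPolytope b |
        (∑ i ∈ I, ContinuousLinearMap.proj (R := ℝ) (φ := fun _ : Fin n => ℝ) i) x =
          topSum b I.card} := by
      ext x
      simp [mem_facetOf_coneCompl]
    rwa [heq]

theorem faceOf_empty (b : Fin n → ℕ) : faceOf b ∅ = parkingPolytope b := by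
  simp [faceOf]

theorem faceOf_insert (b : Fin n → ℕ) (J : Finset (Fin (n + 1)))
    (N : Finset (Finset (Fin (n + 1)))) : faceOf b (insert J N) = facetOf b J ∩ faceOf b N := by
  ext x
  simp only [faceOf, Finset.forall_mem_insert, Set.mem_ofPred_eq, Set.mem_inter_iff]
  tauto

theorem isExposed_faceOf {hn : 0 < n}
    (hB : IsParkingBuildingSet (b ⟨0, hn⟩ = 1) B) (hp : b ⟨0, hn⟩ = 1 → n ≠ 1) (hb : ∀ i, 0 < b i)
    (N : Finset (Finset (Fin (n + 1)))) (hN : ∀ J ∈ N, J ∈ B.sets \ B.maxSets) :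
    IsExposed ℝ (parkingPolytope b) (faceOf b N) := by
  induction N using Finset.induction_on with
  | empty =>
    rw [faceOf_empty]
  | insert J N _ ih =>
    rw [faceOf_insert]
    exact (isExposed_facetOf hB hp hb (hN J (Finset.mem_insert_self _ _))).inter
      (ih fun K hK => hN K (Finset.mem_insert_of_mem hK))

/-- The point of ℱ_N that lies on no facet outside N witnesses M ⊆ N. -/
theorem faceOf_subset_faceOf_iff {hn : 0 < n}
    (hB : IsParkingBuildingSet (b ⟨0, hn⟩ = 1) B) (hp : b ⟨0, hn⟩ = 1 → n ≠ 1) (hb : ∀ i, 0 < b i)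
    {N M : Finset (Finset (Fin (n + 1)))} (hN : B.IsNested N) (hM : B.IsNested M) :
    faceOf b N ⊆ faceOf b M ↔ M ⊆ N := by
  constructor
  · intro h J hJ
    obtain ⟨x, hx, hxN⟩ := hB.exists_mem_facetOf_iff hp hb hN
    have hxf : x ∈ faceOf b N := ⟨hx, fun K hK => (hxN K (hN.subset hK)).2 hK⟩
    exact (hxN J (hM.subset hJ)).1 ((h hxf).2 J hJ)
  · exact fun h x hx => ⟨hx.1, fun J hJ => hx.2 J (h hJ)⟩

theorem faceOf_nonempty {hn : 0 < n}
    (hB : IsParkingBuildingSet (b ⟨0, hn⟩ = 1) B) (hp : b ⟨0, hn⟩ = 1 → n ≠ 1) (hb : ∀ i, 0 < b i)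
    {N : Finset (Finset (Fin (n + 1)))} (hN : B.IsNested N) : (faceOf b N).Nonempty := by
  obtain ⟨x, hx, hxN⟩ := hB.exists_mem_facetOf_iff hp hb hN
  exact ⟨x, hx, fun K hK => (hxN K (hN.subset hK)).2 hK⟩

theorem exists_isNested_eq_faceOf {hn : 0 < n}
    (hB : IsParkingBuildingSet (b ⟨0, hn⟩ = 1) B) (hp : b ⟨0, hn⟩ = 1 → n ≠ 1) (hb : ∀ i, 0 < b i)
    {F : Set (Fin n → ℝ)} (hF : IsExposed ℝ (parkingPolytope b) F) (hne : F.Nonempty) :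
    ∃ N, B.IsNested N ∧ F = faceOf b N := by
  classical
  set a : Fin n ⊕ {I : Finset (Fin n) // I.Nonempty ∧ (b ⟨0, hn⟩ = 1 → Iᶜ.card ≠ 1)} →
      (Fin n → ℝ) →L[ℝ] ℝ := Sum.elim
    (fun i => -ContinuousLinearMap.proj (R := ℝ) (φ := fun _ : Fin n => ℝ) i)
    (fun I => ∑ i ∈ I.1, ContinuousLinearMap.proj (R := ℝ) (φ := fun _ : Fin n => ℝ) i) with ha
  set c : Fin n ⊕ {I : Finset (Fin n) // I.Nonempty ∧ (b ⟨0, hn⟩ = 1 → Iᶜ.card ≠ 1)} → ℝ :=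
    Sum.elim (fun _ => -1) (fun I => topSum b I.1.card) with hc
  have hP : parkingPolytope b = {x | ∀ j, a j x ≤ c j} := by
    ext x
    rw [mem_parkingPolytope_iff hb, Set.mem_ofPred_eq, Sum.forall]
    simp only [ha, hc, Sum.elim_inl, Sum.elim_inr, neg_apply,
      ContinuousLinearMap.proj_apply, sum_apply, neg_le_neg_iff,
      Subtype.forall]
    refine and_congr_right fun h1 => ⟨fun h I _ => h I, fun h I => ?_⟩
    rcases I.eq_empty_or_nonempty with rfl | hI
    · simp [topSum_zero]
    by_cases hI' : b ⟨0, hn⟩ = 1 → Iᶜ.card ≠ 1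
    · exact h I ⟨hI, hI'⟩
    -- For b_1 = 1 and |I| = n - 1 the inequality is redundant: the sum over [n] is at most f(n) =
    -- f(n-1) + 1, and the omitted coordinate is at least 1.
    · push Not at hI'
      obtain ⟨hb1, hcard⟩ := hI'
      have h2 := h Finset.univ ⟨⟨⟨0, hn⟩, Finset.mem_univ _⟩, fun _ => by simp⟩
      obtain ⟨i, hi⟩ := Finset.card_eq_one.1 hcard
      have h3 := Finset.card_add_card_compl I
      have h4 := Finset.sum_add_sum_compl I x
      have h5 := h1 i
      rw [hcard, Fintype.card_fin] at h3
      rw [hi, Finset.sum_singleton] at h4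
      have h6 := topSum_succ b (show I.card < n by omega)
      have h7 : partialSum b ⟨n - I.card - 1, by omega⟩ = b ⟨0, hn⟩ := by
        rw [← partialSum_zero b hn]
        congr 2
        omega
      rw [h7, hb1, h3] at h6
      rw [Finset.card_univ, Fintype.card_fin] at h2
      push_cast at h6
      linarith
  rw [hP] at hF
  obtain ⟨x, hxF, hx⟩ := hF.exists_eq_setOf_tight a c hne
  have hxP : x ∈ parkingPolytope b := by
    rw [hP]
    rw [hx] at hxF
    exact hxF.1
  refine ⟨Finset.univ.filter fun J => J ∈ B.sets \ B.maxSets ∧ x ∈ facetOf b J,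
    hB.isNested_of_tight hp hb hxP fun J hJ => (Finset.mem_filter.1 hJ).2, ?_⟩
  rw [hx]
  ext y
  rw [faceOf, Set.mem_ofPred_eq, Set.mem_ofPred_eq, hP, Set.mem_ofPred_eq]
  refine and_congr_right fun hy => ?_
  have hyP : y ∈ parkingPolytope b := by rwa [hP]
  constructor
  · intro h J hJ
    obtain ⟨hJB, hJx⟩ := (Finset.mem_filter.1 hJ).2
    rcases (hB.mem_diff_maxSets hp J).1 hJB with ⟨i, rfl⟩ | ⟨I, hI, hI', rfl⟩
    · rw [mem_facetOf_singleton] at hJx ⊢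
      refine ⟨hyP, ?_⟩
      simpa [ha, hc, hJx.2] using h (Sum.inl i)
    · rw [mem_facetOf_coneCompl] at hJx ⊢
      refine ⟨hyP, ?_⟩
      simpa [ha, hc, hJx.2] using h (Sum.inr ⟨I, hI, hI'⟩)
  · rintro h (i | ⟨I, hI, hI'⟩) hj
    · have hxi : x i = 1 := by simpa [ha, hc] using hj
      have := h {i.castSucc} (Finset.mem_filter.2 ⟨Finset.mem_univ _,
        (hB.mem_diff_maxSets hp _).2 (Or.inl ⟨i, rfl⟩), mem_facetOf_singleton.2 ⟨hxP, hxi⟩⟩)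
      simp [ha, hc, (mem_facetOf_singleton.1 this).2]
    · have hxI : ∑ i ∈ I, x i = topSum b I.card := by simpa [ha, hc] using hj
      have := h (coneCompl I) (Finset.mem_filter.2 ⟨Finset.mem_univ _,
        (hB.mem_diff_maxSets hp _).2 (Or.inr ⟨I, hI, hI', rfl⟩),
        mem_facetOf_coneCompl.2 ⟨hxP, hxI⟩⟩)
      simpa [ha, hc] using (mem_facetOf_coneCompl.1 this).2

theorem BuildingSet.isNested_singleton {J : Finset (Fin (n + 1))} (hJ : J ∈ B.sets \ B.maxSets) :
    B.IsNested {J} := by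
  refine ⟨by simpa using hJ, fun I hI K hK => ?_, fun M hM hcard => ?_⟩
  · rw [Finset.mem_singleton] at hI hK
    rw [hI, hK]
    exact Or.inl subset_rfl
  · have := Finset.card_le_card hM
    rw [Finset.card_singleton] at this
    omega

theorem BuildingSet.isNested_empty : B.IsNested ∅ :=
  ⟨by simp, by simp, fun M hM hcard => by
    rw [Finset.subset_empty.1 hM, Finset.card_empty] at hcard
    omega⟩

theorem faceOf_singleton {hn : 0 < n}
    (hB : IsParkingBuildingSet (b ⟨0, hn⟩ = 1) B) (hp : b ⟨0, hn⟩ = 1 → n ≠ 1)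
    {J : Finset (Fin (n + 1))} (hJ : J ∈ B.sets \ B.maxSets) : faceOf b {J} = facetOf b J := by
  have h := faceOf_insert b J ∅
  rw [faceOf_empty, insert_empty_eq] at h
  rw [h]
  exact Set.inter_eq_left.2 (facetOf_subset_parkingPolytope hB hp hJ)

/-- A face above F_J comes from a nested subset of {J}, hence is F_J or the polytope; and every
proper nonempty face lies in some F_J. -/
theorem bijOn_facetOf {hn : 0 < n}
    (hB : IsParkingBuildingSet (b ⟨0, hn⟩ = 1) B) (hp : b ⟨0, hn⟩ = 1 → n ≠ 1)
    (hb : ∀ i, 0 < b i) :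
    Set.BijOn (facetOf b) (B.sets \ B.maxSets) {F | IsFacet (parkingPolytope b) F} := by
  have hproper : ∀ J ∈ B.sets \ B.maxSets, facetOf b J ≠ parkingPolytope b := by
    intro J hJ h
    rw [← faceOf_singleton hB hp hJ, ← faceOf_empty] at h
    have := (faceOf_subset_faceOf_iff hB hp hb BuildingSet.isNested_empty
      (BuildingSet.isNested_singleton hJ)).1 h.ge
    exact Finset.notMem_empty J (this (Finset.mem_singleton_self J))
  refine ⟨fun J hJ => ⟨⟨isExposed_facetOf hB hp hb hJ, hproper J hJ⟩, ?_⟩, fun J hJ K hK h => ?_,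
    fun F hF => ?_⟩
  · rintro G ⟨hG, hGP⟩ hle
    have hJN := BuildingSet.isNested_singleton hJ
    rw [← faceOf_singleton hB hp hJ] at hle ⊢
    obtain ⟨N, hN, rfl⟩ := exists_isNested_eq_faceOf hB hp hb hG
      ((faceOf_nonempty hB hp hb hJN).mono hle)
    have h := (faceOf_subset_faceOf_iff hB hp hb hJN hN).1 hle
    rcases Finset.subset_singleton_iff.1 h with rfl | rfl
    · exact absurd (faceOf_empty b) hGP
    · exact le_rfl
  · rw [← faceOf_singleton hB hp hJ, ← faceOf_singleton hB hp hK] at h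
    have := (faceOf_subset_faceOf_iff hB hp hb (BuildingSet.isNested_singleton hJ)
      (BuildingSet.isNested_singleton hK)).1 h.le
    exact (Finset.mem_singleton.1 (this (Finset.mem_singleton_self K))).symm
  · obtain ⟨⟨hFe, hFP⟩, hmax⟩ := hF
    -- The empty face is not maximal, since n > 0 provides the nonempty proper face x_1 = 1.
    rcases F.eq_empty_or_nonempty with rfl | hne
    · have hJ : {(⟨0, hn⟩ : Fin n).castSucc} ∈ B.sets \ B.maxSets :=
        (hB.mem_diff_maxSets hp _).2 (Or.inl ⟨_, rfl⟩)
      have h1 := hmax ⟨isExposed_facetOf hB hp hb hJ, hproper _ hJ⟩ (Set.empty_subset _)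
      have h2 := faceOf_nonempty hB hp hb (BuildingSet.isNested_singleton hJ)
      rw [faceOf_singleton hB hp hJ] at h2
      exact absurd (Set.subset_empty_iff.1 h1) h2.ne_empty
    · obtain ⟨N, hN, rfl⟩ := exists_isNested_eq_faceOf hB hp hb hFe hne
      have hNne : N.Nonempty := by
        rw [Finset.nonempty_iff_ne_empty]
        rintro rfl
        exact hFP (faceOf_empty b)
      obtain ⟨J, hJ⟩ := hNne
      have hle : faceOf b N ⊆ facetOf b J := fun x hx => hx.2 J hJ
      have hJB := hN.subset hJ
      exact ⟨J, hJB, Set.Subset.antisymm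
        (hmax ⟨isExposed_facetOf hB hp hb hJB, hproper J hJB⟩ hle) hle⟩

/-- The face of the polytope that corresponds to a face of the nested set complex, or to the
adjoined greatest element. -/
def faceOfTop (b : Fin n → ℕ) (N : B.NestedFaceLattice) : Set (Fin n → ℝ) :=
  N.recTopCoe ∅ fun N => faceOf b N.1

theorem faceOfTop_subset_faceOfTop_iff {hn : 0 < n}
    (hB : IsParkingBuildingSet (b ⟨0, hn⟩ = 1) B) (hp : b ⟨0, hn⟩ = 1 → n ≠ 1) (hb : ∀ i, 0 < b i)
    (N M : B.NestedFaceLattice) : faceOfTop b N ⊆ faceOfTop b M ↔ M ≤ N := by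
  induction N using WithTop.recTopCoe with
  | top => exact iff_of_true (Set.empty_subset _) le_top
  | coe N =>
    induction M using WithTop.recTopCoe with
    | top =>
      refine iff_of_false (fun h => ?_) (by simp)
      exact (faceOf_nonempty hB hp hb N.2).ne_empty (Set.subset_empty_iff.1 h)
    | coe M =>
      rw [WithTop.coe_le_coe]
      exact faceOf_subset_faceOf_iff hB hp hb N.2 M.2

theorem isExposed_faceOfTop {hn : 0 < n}
    (hB : IsParkingBuildingSet (b ⟨0, hn⟩ = 1) B) (hp : b ⟨0, hn⟩ = 1 → n ≠ 1) (hb : ∀ i, 0 < b i)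
    (N : B.NestedFaceLattice) : IsExposed ℝ (parkingPolytope b) (faceOfTop b N) := by
  induction N using WithTop.recTopCoe with
  -- The empty set is exposed vacuously, as `IsExposed` asks for a functional only when the set is
  -- nonempty.
  | top => exact fun h => absurd h Set.not_nonempty_empty
  | coe N => exact isExposed_faceOf hB hp hb N.1 fun J hJ => N.2.subset hJ

/-- The isomorphism from the dual of the face lattice of the nested set complex onto the face
lattice of the polytope. -/
noncomputable def faceOrderIso {hn : 0 < n}
    (hB : IsParkingBuildingSet (b ⟨0, hn⟩ = 1) B) (hp : b ⟨0, hn⟩ = 1 → n ≠ 1)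
    (hb : ∀ i, 0 < b i) : (B.NestedFaceLattice)ᵒᵈ ≃o PolytopeFaceLattice (parkingPolytope b) :=
  RelIso.ofSurjective
    (OrderEmbedding.ofMapLEIff
      (fun N => ⟨faceOfTop b (OrderDual.ofDual N), isExposed_faceOfTop hB hp hb _⟩)
      fun N M => faceOfTop_subset_faceOfTop_iff hB hp hb (OrderDual.ofDual N) (OrderDual.ofDual M))
    (by
      rintro ⟨F, hF⟩
      rcases F.eq_empty_or_nonempty with rfl | hne
      · exact ⟨OrderDual.toDual ⊤, rfl⟩
      · obtain ⟨N, hN, rfl⟩ := exists_isNested_eq_faceOf hB hp hb hF hne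
        exact ⟨OrderDual.toDual ((⟨N, hN⟩ : B.NestedSetComplex) : B.NestedFaceLattice), rfl⟩)

end Faces

theorem mainTheorem7 (n : ℕ) (hn : 0 < n) (b : Fin n → ℕ) (hb : ∀ i, 0 < b i)
    (hdeg : ¬ (n = 1 ∧ b ⟨0, hn⟩ = 1))
    (B : BuildingSet (Fin (n + 1)))
    (hB : B = if b ⟨0, hn⟩ = 1 then buildingSetPF n else buildingSetSt n) :
    Set.BijOn (facetOf b) (B.sets \ B.maxSets) {F | IsFacet (parkingPolytope b) F} ∧
    ∃ e : (B.NestedFaceLattice)ᵒᵈ ≃o PolytopeFaceLattice (parkingPolytope b),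
      (∀ N : B.NestedSetComplex,
        (e (OrderDual.toDual (N : B.NestedFaceLattice)) : Set (Fin n → ℝ)) = faceOf b N.1) ∧
      (e (OrderDual.toDual (⊤ : B.NestedFaceLattice)) : Set (Fin n → ℝ)) = ∅ := by
  have hB' : IsParkingBuildingSet (b ⟨0, hn⟩ = 1) B := hB ▸ isParkingBuildingSet_ite _
  have hp : b ⟨0, hn⟩ = 1 → n ≠ 1 := fun h1 h2 => hdeg ⟨h2, h1⟩
  exact ⟨bijOn_facetOf hB' hp hb, faceOrderIso hB' hp hb, fun _ => rfl, rfl⟩
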